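/- **Setting.** Let $K$ be a field of characteristic $0$. $\mathrm{GW}(K)$ is its Grothendieck–Witt ring (the group completion of the monoid of isometry classes of nondegenerate symmetric bilinear forms on finite-dimensional $K$-vector spaces under $\oplus$, with product $\otimes$), $\langle u\rangle$ is the class of the form $(x,y)\mapsto uxy$ on $K$ for $u\in K^\times$, and $\mathbb H=\langle 1\rangle+\langle -1\rangle$. Fix integers $k\ge 0$, $a\ge 1$, $g\ge 0$, $\ell_r,\ell_l\ge 1$. Let $H$ be the set of all $(\mathbf w^{(r)},\mathbf w^{(l)})\in\mathbb Z_{>0}^{\ell_r}\times\mathbb Z_{>0}^{\ell_l}$ with all entries odd and $\sum_j \mathbf w^{(r)}_j=b$, $\sum_i \mathbf w^{(l)}_i=ak+b$ for some integer $b$ (which varies with the point of $H$). A *floor diagram* $\mathcal D$ is a finite loopless multigraph on $\{1,\dots,a\}$, up to isomorphisms fixing the vertices, with positive integer edge weights, every edge being oriented towards its larger endpoint. It has genus $g$ if it is connected with first Betti number $g$. The divergence $\operatorname{div}(v)$ is the total weight of the incoming edges minus that of the outgoing edges at $v$. A *marking* of $\mathcal D$ of degree $\Delta_k(\mathbf w^{(r)},\mathbf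 w^{(l)},a)$ is obtained by calling the given vertices white and 1. subdividing every edge by a black vertex, both halves keeping weight and orientation; 2. adding for every $i$ a black vertex with an edge of weight $\mathbf w^{(l)}_i$ from it to a white vertex, and for every $j$ a black vertex with an edge of weight $\mathbf w^{(r)}_j$ from a white vertex to it, such that afterwards every white vertex has divergence exactly $k$; 3. extending the order of the white vertices to a total order of all vertices compatible with the orientation of all edges. Two markings are equivalent if there is an isomorphism of the marked weighted graphs fixing the white vertices and preserving the total orders. Let $\nu(\mathcal D)$ be the number of equivalence classes. The arithmetic multiplicity of an edge of weight $w$ is $\frac{w-1}{2}\mathbb H+\langle w\rangle$ if $w$ is odd and $\frac w2\mathbb H$ if $w$ is even, and $\operatorname{mult}_{\mathbb A^1}(\mathcal D)\in \mathrm{GW}(K)$ is the product of the multiplicities of all edges of the marked diagram (thus every edge of $\mathcal D$ counts twice and every end once). Put $$N^{\mathrm{floor}}_{\mathbb A^1}(k,a,g)(\mathbf w^{(r)},\mathbf w^{(l)})=\sum_{\mathcal D}\operatorname{mult}_{\mathbb A^1}(\mathcal D)\,\nu(\mathcal D)\in\mathrm{GW}(K),$$ the sum running over all floor diagrams of genus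 $g$; only finitely many terms are non-zero. **Theorem.** There is a function $M\colon H\to\mathbb Z$ such that for all $(\mathbf w^{(r)},\mathbf w^{(l)})\in H$ $$N^{\mathrm{floor}}_{\mathbb A^1}(k,a,g)(\mathbf w^{(r)},\mathbf w^{(l)})=M(\mathbf w^{(r)},\mathbf w^{(l)})\cdot\mathbb H+\sum_{\mathcal D}\nu(\mathcal D)\,\Big\langle(-1)^{i_{\mathcal D}}\prod_j\mathbf w^{(r)}_j\prod_i\mathbf w^{(l)}_i\Big\rangle$$ for suitable integers $i_{\mathcal D}\ge 0$ (depending also on $(\mathbf w^{(r)},\mathbf w^{(l)})$), the sum running over the floor diagrams $\mathcal D$ of genus $g$ all of whose edge weights are odd. (Comparing ranks, this determines $M$.) The coefficient $M$ is piecewise polynomial in the entries of $\mathbf w^{(r)}$ and $\mathbf w^{(l)}$: there are finitely many affine-linear forms with rational coefficients on $\mathbb Q^{\ell_r+\ell_l}$ such that, on the set of all points of $H$ at which each of these forms has a prescribed sign (negative, zero or positive), $M$ is given by a polynomial with rational coefficients. The same holds if in all sums only those floor diagrams are admitted that satisfy $\operatorname{div}(v)\le k$ at every vertex $v$. -/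

import Mathlib

open scoped TensorProduct

universe u

/-- A quadratic space over `K`: a finite-dimensional `K`-vector space with a nondegenerate
symmetric bilinear form. -/
structure QuadSpace (K : Type u) [Field K] where
  carrier : Type u
  [addCommGroup : AddCommGroup carrier]
  [module : Module K carrier]
  [finiteDimensional : FiniteDimensional K carrier]
  form : LinearMap.BilinForm K carrier
  isSymm : form.IsSymm
  nondegenerate : form.Nondegenerate

namespace QuadSpace

attribute [instance] addCommGroup module finiteDimensional

variable {K : Type u} [Field K]

/-- Two quadratic spaces are isometric if a linear isomorphism carries one form to the other. -/
def Isometric (X Y : QuadSpace K) : Prop :=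
  ∃ e : X.carrier ≃ₗ[K] Y.carrier, ∀ x y, Y.form (e x) (e y) = X.form x y

instance setoid (K : Type u) [Field K] : Setoid (QuadSpace K) where
  r := Isometric
  iseqv :=
    { refl := fun _ => ⟨LinearEquiv.refl K _, fun _ _ => rfl⟩
      symm := fun ⟨e, he⟩ => ⟨e.symm, fun x y => by rw [← he]; simp⟩
      trans := fun ⟨e, he⟩ ⟨f, hf⟩ => ⟨e.trans f, fun x y => by simp [he, hf]⟩ }

/-- The orthogonal direct sum. -/
def directSum (X Y : QuadSpace K) : QuadSpace K where
  carrier := X.carrier × Y.carrier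
  form := X.form.compl₁₂ (LinearMap.fst K _ _) (LinearMap.fst K _ _) +
    Y.form.compl₁₂ (LinearMap.snd K _ _) (LinearMap.snd K _ _)
  isSymm := ⟨fun x y => by simp [X.isSymm.eq x.1 y.1, Y.isSymm.eq x.2 y.2]⟩
  nondegenerate := by
    constructor
    · intro x hx
      refine Prod.ext (X.nondegenerate.1 _ fun y => ?_) (Y.nondegenerate.1 _ fun y => ?_)
      · simpa using hx (y, 0)
      · simpa using hx (0, y)
    · intro x hx
      refine Prod.ext (X.nondegenerate.2 _ fun y => ?_) (Y.nondegenerate.2 _ fun y => ?_)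
      · simpa using hx (y, 0)
      · simpa using hx (0, y)

theorem directSum_form (X Y : QuadSpace K) (x y : X.carrier × Y.carrier) :
    (X.directSum Y).form x y = X.form x.1 y.1 + Y.form x.2 y.2 := rfl

/-- The form `(v ⊗ w, v' ⊗ w') ↦ B v v' * C w w'` on a tensor product. -/
noncomputable def tmulForm {V W : Type*} [AddCommGroup V] [Module K V] [AddCommGroup W] [Module K W]
    (B : LinearMap.BilinForm K V) (C : LinearMap.BilinForm K W) :
    LinearMap.BilinForm K (V ⊗[K] W) :=
  LinearMap.BilinForm.tmul B C

theorem tmulForm_tmul {V W : Type*} [AddCommGroup V] [Module K V] [AddCommGroup W] [Module K W]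
    (B : LinearMap.BilinForm K V) (C : LinearMap.BilinForm K W) (v v' : V) (w w' : W) :
    tmulForm B C (v ⊗ₜ[K] w) (v' ⊗ₜ[K] w') = B v v' * C w w' :=
  mul_comm _ _

theorem isSymm_tmulForm {V W : Type*} [AddCommGroup V] [Module K V] [AddCommGroup W] [Module K W]
    {B : LinearMap.BilinForm K V} {C : LinearMap.BilinForm K W} (hB : B.IsSymm) (hC : C.IsSymm) :
    (tmulForm B C).IsSymm :=
  LinearMap.BilinForm.isSymm_iff.2 (LinearMap.IsSymm.tmul
    (LinearMap.BilinForm.isSymm_iff.1 hB) (LinearMap.BilinForm.isSymm_iff.1 hC))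

/-- The tensor product, with form `(x ⊗ y, x' ⊗ y') ↦ X.form x x' * Y.form y y'`. -/
noncomputable def tensor (X Y : QuadSpace K) : QuadSpace K where
  carrier := X.carrier ⊗[K] Y.carrier
  form := tmulForm X.form Y.form
  isSymm := isSymm_tmulForm X.isSymm Y.isSymm
  nondegenerate := by
    have hs : (tmulForm X.form Y.form).IsSymm := isSymm_tmulForm X.isSymm Y.isSymm
    have key : ∀ x, (∀ y, tmulForm X.form Y.form x y = 0) → x = 0 := by
      intro x hx
      let e : X.carrier ⊗[K] Y.carrier ≃ₗ[K] Module.Dual K (X.carrier ⊗[K] Y.carrier) :=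
        (TensorProduct.congr (X.form.toDual X.nondegenerate) (Y.form.toDual Y.nondegenerate)).trans
          (TensorProduct.dualDistribEquiv K X.carrier Y.carrier)
      have he : e.toLinearMap = tmulForm X.form Y.form := by
        ext a b c d
        exact mul_comm _ _
      have : e x = 0 := by
        ext1
        ext a b
        have := hx (a ⊗ₜ b)
        rw [← he] at this
        exact this
      simpa using this
    exact ⟨key, fun x hx => key x fun y => by rw [← hx y]; exact (hs.eq x y)⟩

/-- The zero space. -/
def zero (K : Type u) [Field K] : QuadSpace K where
  carrier := PUnit.{u + 1}
  form := 0
  isSymm := ⟨fun _ _ => by simp⟩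
  nondegenerate := ⟨fun _ _ => rfl, fun _ _ => rfl⟩

/-- The one-dimensional quadratic space `⟨a⟩`, i.e. `K` with the form `(x, y) ↦ a * x * y`. -/
def line (a : Kˣ) : QuadSpace K where
  carrier := K
  form := (a : K) • LinearMap.mul K K
  isSymm := ⟨fun x y => by simp [mul_comm]⟩
  nondegenerate :=
    ⟨fun x hx => by simpa using hx 1, fun x hx => by simpa using hx 1⟩

theorem line_form (a : Kˣ) (x y : K) : (line a).form x y = a * (x * y) := rfl

theorem tmul_isometry {V W U : Type*} [AddCommGroup V] [Module K V] [AddCommGroup W] [Module K W]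
    [AddCommGroup U] [Module K U] (B : LinearMap.BilinForm K V) (C : LinearMap.BilinForm K W)
    (D : LinearMap.BilinForm K U) (e : V ⊗[K] W →ₗ[K] U)
    (h : ∀ v v' w w', D (e (v ⊗ₜ[K] w)) (e (v' ⊗ₜ[K] w')) = B v v' * C w w') (s t : V ⊗[K] W) :
    D (e s) (e t) = tmulForm B C s t := by
  have : D.compl₁₂ e e = tmulForm B C := by
    ext v w v' w'
    exact (h v v' w w').trans (mul_comm _ _)
  exact LinearMap.congr_fun₂ this s t

theorem tmul_assoc_isometry {V W U : Type*} [AddCommGroup V] [Module K V] [AddCommGroup W]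
    [Module K W] [AddCommGroup U] [Module K U] (B : LinearMap.BilinForm K V)
    (C : LinearMap.BilinForm K W) (D : LinearMap.BilinForm K U) (s t : (V ⊗[K] W) ⊗[K] U) :
    tmulForm B (tmulForm C D) (TensorProduct.assoc K V W U s) (TensorProduct.assoc K V W U t) =
      tmulForm (tmulForm B C) D s t := by
  have : (tmulForm B (tmulForm C D)).compl₁₂ (TensorProduct.assoc K V W U).toLinearMap
      (TensorProduct.assoc K V W U).toLinearMap = tmulForm (tmulForm B C) D := by
    ext v w u v' w' u'
    exact mul_assoc (D u u') (C w w') (B v v')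
  exact LinearMap.congr_fun₂ this s t

theorem directSum_congr {X X' Y Y' : QuadSpace K} (h : Isometric X X') (h' : Isometric Y Y') :
    Isometric (X.directSum Y) (X'.directSum Y') := by
  obtain ⟨e, he⟩ := h
  obtain ⟨f, hf⟩ := h'
  exact ⟨e.prodCongr f, fun x y => congrArg₂ (· + ·) (he x.1 y.1) (hf x.2 y.2)⟩

theorem tensor_congr {X X' Y Y' : QuadSpace K} (h : Isometric X X') (h' : Isometric Y Y') :
    Isometric (X.tensor Y) (X'.tensor Y') := by
  obtain ⟨e, he⟩ := h
  obtain ⟨f, hf⟩ := h'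
  refine ⟨TensorProduct.congr e f, tmul_isometry X.form Y.form (tmulForm X'.form Y'.form)
    (TensorProduct.congr e f).toLinearMap fun x x' y y' => ?_⟩
  rw [← he, ← hf]
  exact mul_comm _ _

theorem directSum_comm (X Y : QuadSpace K) : Isometric (X.directSum Y) (Y.directSum X) :=
  ⟨LinearEquiv.prodComm K _ _, fun _ _ => add_comm _ _⟩

theorem directSum_assoc (X Y Z : QuadSpace K) :
    Isometric ((X.directSum Y).directSum Z) (X.directSum (Y.directSum Z)) :=
  ⟨LinearEquiv.prodAssoc K _ _ _, fun _ _ => (add_assoc _ _ _).symm⟩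

theorem zero_directSum (X : QuadSpace K) : Isometric ((zero K).directSum X) X :=
  ⟨LinearEquiv.uniqueProd (M₂ := PUnit.{u + 1}), fun _ _ => (zero_add _).symm⟩

theorem tensor_comm (X Y : QuadSpace K) : Isometric (X.tensor Y) (Y.tensor X) :=
  ⟨TensorProduct.comm K X.carrier Y.carrier, tmul_isometry X.form Y.form (tmulForm Y.form X.form)
    (TensorProduct.comm K X.carrier Y.carrier).toLinearMap fun _ _ _ _ => rfl⟩

theorem one_tensor (X : QuadSpace K) : Isometric ((line 1).tensor X) X :=
  ⟨TensorProduct.lid K X.carrier, tmul_isometry (line (1 : Kˣ)).form X.form X.form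
    (TensorProduct.lid K X.carrier).toLinearMap fun (x x' : K) y y' => by
      change X.form (x • y) (x' • y') = (((1 : Kˣ) : K) * (x * x')) * X.form y y'
      simp only [map_smul, LinearMap.smul_apply, smul_eq_mul, Units.val_one]
      ring⟩

theorem zero_tensor (X : QuadSpace K) : Isometric ((zero K).tensor X) (zero K) := by
  have : Subsingleton (PUnit.{u + 1} ⊗[K] X.carrier) := inferInstance
  refine ⟨(0 : PUnit.{u + 1} ⊗[K] X.carrier ≃ₗ[K] PUnit.{u + 1}), fun x y => ?_⟩
  have hx : x = 0 := Subsingleton.elim (α := PUnit.{u + 1} ⊗[K] X.carrier) x 0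
  subst hx
  exact (LinearMap.congr_fun (map_zero ((zero K).tensor X).form) y).symm

theorem tensor_directSum (X Y Z : QuadSpace K) :
    Isometric (X.tensor (Y.directSum Z)) ((X.tensor Y).directSum (X.tensor Z)) :=
  ⟨TensorProduct.prodRight K K X.carrier Y.carrier Z.carrier,
    tmul_isometry X.form (Y.directSum Z).form ((X.tensor Y).directSum (X.tensor Z)).form
      (TensorProduct.prodRight K K X.carrier Y.carrier Z.carrier).toLinearMap fun x x' y y' => by
        exact (congrArg₂ (· + ·) (mul_comm _ _) (mul_comm _ _)).trans (mul_add _ _ _).symm⟩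

theorem tensor_assoc (X Y Z : QuadSpace K) :
    Isometric ((X.tensor Y).tensor Z) (X.tensor (Y.tensor Z)) :=
  ⟨TensorProduct.assoc K X.carrier Y.carrier Z.carrier,
    tmul_assoc_isometry X.form Y.form Z.form⟩

end QuadSpace

/-- The isometry classes of quadratic spaces over `K`. -/
def QuadClass (K : Type u) [Field K] : Type (u + 1) := Quotient (QuadSpace.setoid K)

namespace QuadClass

variable {K : Type u} [Field K]

/-- The isometry class of a quadratic space. -/
def mk (X : QuadSpace K) : QuadClass K := Quotient.mk (QuadSpace.setoid K) X

/-- Addition of isometry classes is the orthogonal direct sum. -/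
noncomputable instance : Add (QuadClass K) :=
  ⟨Quotient.map₂ QuadSpace.directSum fun _ _ h _ _ h' => QuadSpace.directSum_congr h h'⟩

/-- Multiplication of isometry classes is the tensor product. -/
noncomputable instance : Mul (QuadClass K) :=
  ⟨Quotient.map₂ QuadSpace.tensor fun _ _ h _ _ h' => QuadSpace.tensor_congr h h'⟩

noncomputable instance : Zero (QuadClass K) := ⟨mk (QuadSpace.zero K)⟩

noncomputable instance : One (QuadClass K) := ⟨mk (QuadSpace.line 1)⟩

noncomputable instance : CommSemiring (QuadClass K) where
  nsmul := nsmulRec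
  add_assoc := by rintro ⟨X⟩ ⟨Y⟩ ⟨Z⟩; exact Quotient.sound (QuadSpace.directSum_assoc X Y Z)
  add_comm := by rintro ⟨X⟩ ⟨Y⟩; exact Quotient.sound (QuadSpace.directSum_comm X Y)
  zero_add := by rintro ⟨X⟩; exact Quotient.sound (QuadSpace.zero_directSum X)
  add_zero := by
    rintro ⟨X⟩
    exact Quotient.sound
      ((QuadSpace.setoid K).trans (QuadSpace.directSum_comm _ _) (QuadSpace.zero_directSum X))
  mul_assoc := by rintro ⟨X⟩ ⟨Y⟩ ⟨Z⟩; exact Quotient.sound (QuadSpace.tensor_assoc X Y Z)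
  mul_comm := by rintro ⟨X⟩ ⟨Y⟩; exact Quotient.sound (QuadSpace.tensor_comm X Y)
  one_mul := by rintro ⟨X⟩; exact Quotient.sound (QuadSpace.one_tensor X)
  mul_one := by
    rintro ⟨X⟩
    exact Quotient.sound
      ((QuadSpace.setoid K).trans (QuadSpace.tensor_comm _ _) (QuadSpace.one_tensor X))
  zero_mul := by rintro ⟨X⟩; exact Quotient.sound (QuadSpace.zero_tensor X)
  mul_zero := by
    rintro ⟨X⟩
    exact Quotient.sound
      ((QuadSpace.setoid K).trans (QuadSpace.tensor_comm _ _) (QuadSpace.zero_tensor X))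
  left_distrib := by
    rintro ⟨X⟩ ⟨Y⟩ ⟨Z⟩; exact Quotient.sound (QuadSpace.tensor_directSum X Y Z)
  right_distrib := by
    rintro ⟨X⟩ ⟨Y⟩ ⟨Z⟩
    exact Quotient.sound ((QuadSpace.setoid K).trans (QuadSpace.tensor_comm _ _)
      ((QuadSpace.setoid K).trans (QuadSpace.tensor_directSum Z X Y)
        (QuadSpace.directSum_congr (QuadSpace.tensor_comm _ _) (QuadSpace.tensor_comm _ _))))

end QuadClass

/-- The Grothendieck-Witt ring of `K`: the group completion of the monoid of isometry classes of
quadratic spaces under orthogonal sum, with the multiplication induced by the tensor product. -/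
def GW (K : Type u) [Field K] : Type (u + 1) := Algebra.GrothendieckAddGroup (QuadClass K)

namespace GW

variable {K : Type u} [Field K]

noncomputable instance : AddCommGroup (GW K) :=
  inferInstanceAs (AddCommGroup (Algebra.GrothendieckAddGroup (QuadClass K)))

/-- The class in `GW K` of an isometry class. -/
noncomputable def ofClass : QuadClass K →+ GW K := Algebra.GrothendieckAddGroup.of

theorem hom_ext {G : Type*} [AddCommGroup G] {f g : GW K →+ G}
    (h : ∀ x, f (ofClass x) = g (ofClass x)) : f = g :=
  Algebra.GrothendieckAddGroup.lift.symm.injective (AddMonoidHom.ext h)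

/-- Extension of additive maps from isometry classes to `GW K`. -/
noncomputable def lift {G : Type*} [AddCommGroup G] (f : QuadClass K →+ G) : GW K →+ G :=
  Algebra.GrothendieckAddGroup.lift f

@[simp]
theorem lift_ofClass {G : Type*} [AddCommGroup G] (f : QuadClass K →+ G) (x : QuadClass K) :
    lift f (ofClass x) = f x :=
  DFunLike.congr_fun (Algebra.GrothendieckAddGroup.lift.symm_apply_apply f) x

/-- The biadditive extension of the tensor product to `GW K`. -/
noncomputable def mulHom : GW K →+ GW K →+ GW K :=
  lift
    { toFun := fun x => lift (ofClass.comp (AddMonoidHom.mulLeft x))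
      map_zero' := hom_ext fun y => by simp
      map_add' := fun x x' => hom_ext fun y => by simp [add_mul] }

theorem mulHom_ofClass (x y : QuadClass K) :
    mulHom (ofClass x) (ofClass y) = ofClass (x * y) := by
  simp [mulHom]

noncomputable instance : Mul (GW K) := ⟨fun x y => mulHom x y⟩

noncomputable instance : One (GW K) := ⟨ofClass 1⟩

theorem mul_def (x y : GW K) : x * y = mulHom x y := rfl

theorem ofClass_mul (x y : QuadClass K) : ofClass (x * y) = ofClass x * ofClass y :=
  (mulHom_ofClass x y).symm

protected theorem mul_comm (x y : GW K) : x * y = y * x := by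
  have : mulHom (K := K) = mulHom.flip :=
    hom_ext fun x => hom_ext fun y => by simp [mulHom_ofClass, mul_comm]
  exact DFunLike.congr_fun (DFunLike.congr_fun this x) y

protected theorem mul_assoc (x y z : GW K) : x * y * z = x * (y * z) := by
  have h₁ : ∀ (a b : QuadClass K) (z : GW K),
      mulHom (mulHom (ofClass a) (ofClass b)) z = mulHom (ofClass a) (mulHom (ofClass b) z) := by
    intro a b z
    have : mulHom (mulHom (ofClass a) (ofClass b)) = (mulHom (ofClass a)).comp (mulHom (ofClass b)) :=
      hom_ext fun c => by simp [mulHom_ofClass, mul_assoc]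
    exact DFunLike.congr_fun this z
  have h₂ : ∀ (a : QuadClass K) (y z : GW K),
      mulHom (mulHom (ofClass a) y) z = mulHom (ofClass a) (mulHom y z) := by
    intro a y z
    have : (mulHom.flip z).comp (mulHom (ofClass a)) =
        (mulHom (ofClass a)).comp (mulHom.flip z) := hom_ext fun b => h₁ a b z
    exact DFunLike.congr_fun this y
  have h₃ : (mulHom.flip z).comp (mulHom.flip y) = mulHom.flip (mulHom y z) :=
    hom_ext fun a => h₂ a y z
  exact DFunLike.congr_fun h₃ x

protected theorem one_mul (x : GW K) : 1 * x = x := by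
  have : mulHom (1 : GW K) = AddMonoidHom.id _ := hom_ext fun y => by
    change mulHom (ofClass 1) (ofClass y) = _
    simp [mulHom_ofClass]
  exact DFunLike.congr_fun this x

noncomputable instance : CommRing (GW K) where
  __ := (inferInstance : AddCommGroup (GW K))
  mul_assoc := GW.mul_assoc
  mul_comm := GW.mul_comm
  one_mul := GW.one_mul
  mul_one x := by rw [GW.mul_comm, GW.one_mul]
  left_distrib x y z := map_add (mulHom x) y z
  right_distrib x y z := by rw [mul_def, map_add]; rfl
  zero_mul x := by rw [mul_def, map_zero]; rfl
  mul_zero x := map_zero (mulHom x)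

/-- The class `⟨a⟩` of the one-dimensional form `(x, y) ↦ a * x * y`. -/
noncomputable def unitForm (a : Kˣ) : GW K := ofClass (QuadClass.mk (QuadSpace.line a))

/-- The class of the hyperbolic plane, `⟨1⟩ + ⟨-1⟩`. -/
noncomputable def hyperbolic (K : Type u) [Field K] : GW K := unitForm 1 + unitForm (-1)

end GW

/-! ### Floor diagrams

A floor diagram is a finite loopless multigraph on the totally ordered set of vertices `Fin a`, with
positive integer edge weights, considered up to isomorphisms that fix the vertices. Every edge is
oriented towards its larger endpoint, so that such a diagram is a multiset of weighted edges. -/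

/-- A weighted edge between two vertices of `Fin a`, oriented towards the larger one. -/
@[ext]
structure FloorEdge (a : ℕ) where
  src : Fin a
  tgt : Fin a
  src_lt_tgt : src < tgt
  weight : ℕ+
  deriving DecidableEq

/-- A floor diagram on the vertex set `Fin a`. -/
@[ext]
structure FloorDiagram (a : ℕ) where
  edges : Multiset (FloorEdge a)

/-- The weights of `lr` right ends (indexed by `Sum.inl`) and `ll` left ends (`Sum.inr`). -/
abbrev EndWeights (lr ll : ℕ) : Type := Fin lr ⊕ Fin ll → ℕ+

/-- The set of pairs of tuples `(w^r, w^l)` with odd entries such that, for some `b`, the entries of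
`w^r` sum to `b` and the entries of `w^l` sum to `a * k + b`. -/
def oddEndWeights (k a lr ll : ℕ) : Set (EndWeights lr ll) :=
  {w | (∀ x, Odd (w x : ℕ)) ∧ ∃ b : ℕ, ∑ j, (w (Sum.inl j) : ℕ) = b ∧
    ∑ i, (w (Sum.inr i) : ℕ) = a * k + b}

namespace FloorDiagram

variable {a : ℕ} (D : FloorDiagram a)

/-- The divergence at `v`: total weight of the incoming minus total weight of the outgoing edges. -/
def div (v : Fin a) : ℤ :=
  ((D.edges.filter fun e => e.tgt = v).map fun e => ((e.weight : ℕ) : ℤ)).sum -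
    ((D.edges.filter fun e => e.src = v).map fun e => ((e.weight : ℕ) : ℤ)).sum

/-- The simple graph obtained by forgetting weights and multiplicities of edges. -/
def graph : SimpleGraph (Fin a) :=
  SimpleGraph.fromRel fun u v => ∃ e ∈ D.edges, e.src = u ∧ e.tgt = v

/-- The genus (first Betti number) of a connected floor diagram. -/
def genus : ℤ := (Multiset.card D.edges : ℤ) - a + 1

/-- `D` is connected of genus `g`, and all its divergences are at most `c` (for `c = ⊤` this last
condition is empty). -/
def IsAdmissible (g : ℕ) (c : WithTop ℤ) : Prop :=
  D.graph.Connected ∧ D.genus = g ∧ ∀ v, (D.div v : WithTop ℤ) ≤ c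

/-- All edges of `D` have odd weight. -/
def IsOdd : Prop := ∀ e ∈ D.edges, Odd (e.weight : ℕ)

/-- The vertices of the marked floor diagrams arising from `D`: the white vertices, and the black
vertices, namely one on each edge of `D` and one at the tip of each left end and each right end. -/
inductive MarkedVertex (D : FloorDiagram a) (lr ll : ℕ) : Type
  | white (v : Fin a)
  | edge (e : D.edges.ToType)
  | right (j : Fin lr)
  | left (i : Fin ll)

variable {lr ll : ℕ}

/-- The weighted oriented edges of a marked floor diagram arising from `D`: each edge of `D` is
subdivided into two edges of the same weight, each left end leads from its black vertex to a white
vertex, and each right end leads from a white vertex to its black vertex. -/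
inductive MarkedArc (w : EndWeights lr ll) (rightSrc : Fin lr → Fin a) (leftTgt : Fin ll → Fin a) :
    D.MarkedVertex lr ll → D.MarkedVertex lr ll → ℕ+ → Prop
  | firstHalf (e : D.edges.ToType) : MarkedArc w rightSrc leftTgt (.white e.1.src) (.edge e) e.1.weight
  | secondHalf (e : D.edges.ToType) : MarkedArc w rightSrc leftTgt (.edge e) (.white e.1.tgt) e.1.weight
  | right (j : Fin lr) : MarkedArc w rightSrc leftTgt (.white (rightSrc j)) (.right j) (w (Sum.inl j))
  | left (i : Fin ll) : MarkedArc w rightSrc leftTgt (.left i) (.white (leftTgt i)) (w (Sum.inr i))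

/-- A marking of `D`: the right and left ends of the prescribed weights are attached to white
vertices, such that every white vertex has divergence `k`, and the order of the white vertices is
extended to a total order on all vertices, compatible with the orientation of all edges. -/
structure Marking (k : ℕ) (w : EndWeights lr ll) where
  rightSrc : Fin lr → Fin a
  leftTgt : Fin ll → Fin a
  div_eq : ∀ v, D.div v + ∑ i with leftTgt i = v, ((w (Sum.inr i) : ℕ) : ℤ) -
    ∑ j with rightSrc j = v, ((w (Sum.inl j) : ℕ) : ℤ) = k
  lt : D.MarkedVertex lr ll → D.MarkedVertex lr ll → Prop
  isStrictTotalOrder : IsStrictTotalOrder _ lt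
  white_lt_white : ∀ u v, lt (.white u) (.white v) ↔ u < v
  lt_of_arc : ∀ x y n, D.MarkedArc w rightSrc leftTgt x y n → lt x y

/-- Two markings of `D` are equivalent if there is an isomorphism of weighted graphs between them
which fixes the white vertices and preserves the total orders. -/
def Marking.Equivalent {D : FloorDiagram a} {k : ℕ} {w : EndWeights lr ll} (m m' : D.Marking k w) :
    Prop :=
  ∃ σ : D.MarkedVertex lr ll ≃ D.MarkedVertex lr ll,
    (∀ v, σ (.white v) = .white v) ∧
    (∀ x y n, D.MarkedArc w m.rightSrc m.leftTgt x y n ↔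
      D.MarkedArc w m'.rightSrc m'.leftTgt (σ x) (σ y) n) ∧
    ∀ x y, m.lt x y ↔ m'.lt (σ x) (σ y)

instance Marking.setoid {D : FloorDiagram a} (k : ℕ) (w : EndWeights lr ll) :
    Setoid (D.Marking k w) where
  r := Marking.Equivalent
  iseqv :=
    { refl := fun _ => ⟨Equiv.refl _, fun _ => rfl, fun _ _ _ => Iff.rfl, fun _ _ => Iff.rfl⟩
      symm := fun ⟨σ, h₁, h₂, h₃⟩ => ⟨σ.symm, fun v => by rw [Equiv.symm_apply_eq, h₁],
        fun x y n => by simp [h₂], fun x y => by simp [h₃]⟩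
      trans := fun ⟨σ, h₁, h₂, h₃⟩ ⟨τ, k₁, k₂, k₃⟩ => ⟨σ.trans τ, fun v => by simp [h₁, k₁],
        fun x y n => by simp [h₂, k₂], fun x y => by simp [h₃, k₃]⟩ }

/-- The number of markings of `D` up to equivalence. -/
noncomputable def numMarkings (k : ℕ) (w : EndWeights lr ll) : ℕ :=
  Nat.card (Quotient (Marking.setoid (D := D) k w))

/-- The weights of all edges of a marked floor diagram arising from `D`; each edge of `D`
contributes the weights of its two halves. -/
def markedWeights (w : EndWeights lr ll) : Multiset ℕ+ :=
  (D.edges.map fun e => e.weight) + (D.edges.map fun e => e.weight) + Finset.univ.val.map w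

end FloorDiagram

section Arithmetic

variable (K : Type u) [Field K] [CharZero K]

/-- A positive integer as a unit of a field of characteristic zero. -/
def natUnit (n : ℕ+) : Kˣ := Units.mk0 ((n : ℕ) : K) (Nat.cast_ne_zero.2 n.ne_zero)

/-- The arithmetic multiplicity of an edge of weight `n`. -/
noncomputable def edgeMult (n : ℕ+) : GW K :=
  if Odd (n : ℕ) then (((n : ℕ) - 1) / 2) • GW.hyperbolic K + GW.unitForm (natUnit K n)
  else ((n : ℕ) / 2) • GW.hyperbolic K

/-- The arithmetic multiplicity of a floor diagram with ends of weights `w`: the product of the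
arithmetic multiplicities of all edges of the associated marked floor diagrams. -/
noncomputable def FloorDiagram.mult {a lr ll : ℕ} (D : FloorDiagram a) (w : EndWeights lr ll) :
    GW K :=
  ((D.markedWeights w).map (edgeMult K)).prod

/-- The arithmetic count of the connected floor diagrams of genus `g` on `a` vertices with
divergences at most `c`, each one weighted by its multiplicity and by its number of markings.
Only finitely many of them have a marking, so that the sum is a finite one. -/
noncomputable def floorCount (k a g : ℕ) (c : WithTop ℤ) {lr ll : ℕ} (w : EndWeights lr ll) :
    GW K :=
  ∑ᶠ (D : FloorDiagram a) (_ : D.IsAdmissible g c), D.numMarkings k w • D.mult K w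

end Arithmetic

/-- `f` is piecewise polynomial on `S`: there are finitely many affine-linear forms with rational
coefficients such that on the set of all points of `S` at which they have any prescribed signs
(negative, zero or positive), `f` is given by a polynomial with rational coefficients. -/
def IsPiecewisePolynomialOn {ι : Type*} [Fintype ι] (S : Set (ι → ℕ+)) (f : (ι → ℕ+) → ℤ) : Prop :=
  ∃ (m : ℕ) (A : Fin m → ι → ℚ) (B : Fin m → ℚ), ∀ s : Fin m → SignType,
    ∃ p : MvPolynomial ι ℚ, ∀ x ∈ S,
      (∀ t, SignType.sign (∑ i, A t i * ((x i : ℕ) : ℚ) + B t) = s t) →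
        (f x : ℚ) = MvPolynomial.eval (fun i => ((x i : ℕ) : ℚ)) p

/-!
The multiplicity of an edge is multiplicative in its weight. So a marked floor diagram whose weights
have product `P` has multiplicity `⌊P / 2⌋ • ℍ`, plus `⟨P⟩` if `P` is odd, and up to squares `P` is
the product of the weights of the ends, because every edge of the floor diagram counts twice.
Therefore `2 M(w)` is the product of the end weights times the sum of `ν(D) * (∏ edge weights)²`
over all floor diagrams, minus the sum of `ν(D)` over the odd ones.

Labelling the edges and the ends turns both sums into finite sums, over combinatorial types, of the
values of a polynomial at the positive flows, congruent to `1` modulo `s = 1, 2`, with given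
divergences. Such a sum is piecewise polynomial in the divergences: if some circulation is non-zero,
then shifting the lower bounds of the flows along it changes the sum only by sums with fewer free
edges, and the sum itself is then obtained by taking antidifferences; otherwise a flow is determined
by its divergences.
-/

namespace GW

variable {K : Type u} [Field K]

theorem ofClass_mk_eq {X Y : QuadSpace K} (h : QuadSpace.Isometric X Y) :
    ofClass (QuadClass.mk X) = ofClass (QuadClass.mk Y) :=
  congrArg ofClass (Quotient.sound h)

theorem unitForm_one : unitForm (1 : Kˣ) = 1 := rfl

theorem unitForm_mul (a b : Kˣ) : unitForm (a * b) = unitForm a * unitForm b := by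
  rw [unitForm, unitForm, unitForm, ← ofClass_mul]
  refine (ofClass_mk_eq (X := (QuadSpace.line a).tensor (QuadSpace.line b))
    (Y := QuadSpace.line (a * b)) ⟨TensorProduct.lid K K, QuadSpace.tmul_isometry
      (QuadSpace.line a).form (QuadSpace.line b).form (QuadSpace.line (a * b)).form
      (TensorProduct.lid K K).toLinearMap fun (x x' : K) (y y' : K) => ?_⟩).symm
  change ((a * b : Kˣ) : K) * ((x * y) * (x' * y')) = (a * (x * x')) * (b * (y * y'))
  push_cast
  ring

theorem unitForm_sq_mul (a b : Kˣ) : unitForm (b ^ 2 * a) = unitForm a := by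
  refine ofClass_mk_eq ⟨LinearEquiv.smulOfUnit b, fun (x y : K) => ?_⟩
  change (a : K) * (((b : K) * x) * ((b : K) * y)) = ((b ^ 2 * a : Kˣ) : K) * (x * y)
  push_cast
  ring

theorem unitForm_add_unitForm_neg [NeZero (2 : K)] (u : Kˣ) :
    unitForm u + unitForm (-u) = hyperbolic K := by
  have hu : (u : K) ≠ 0 := u.ne_zero
  have h2 : (2 : K) ≠ 0 := two_ne_zero
  -- `e` multiplies the coordinate `p.1 + p.2` by `u` and fixes the coordinate `p.1 - p.2`.
  let e : (K × K) ≃ₗ[K] (K × K) :=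
    { toFun := fun p => (((u : K) + 1) / 2 * p.1 + ((u : K) - 1) / 2 * p.2,
        ((u : K) - 1) / 2 * p.1 + ((u : K) + 1) / 2 * p.2)
      invFun := fun p => (((u : K)⁻¹ + 1) / 2 * p.1 + ((u : K)⁻¹ - 1) / 2 * p.2,
        ((u : K)⁻¹ - 1) / 2 * p.1 + ((u : K)⁻¹ + 1) / 2 * p.2)
      map_add' := fun p q => by ext <;> simp <;> ring
      map_smul' := fun c p => by ext <;> simp <;> ring
      left_inv := fun p => by ext <;> simp <;> field_simp <;> ring
      right_inv := fun p => by ext <;> simp <;> field_simp <;> ring }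
  have he : QuadSpace.Isometric ((QuadSpace.line u).directSum (QuadSpace.line (-u)))
      ((QuadSpace.line 1).directSum (QuadSpace.line (-1))) := by
    refine ⟨e, fun (x y : K × K) => ?_⟩
    change ((1 : Kˣ) : K) * ((e x).1 * (e y).1) + ((-1 : Kˣ) : K) * ((e x).2 * (e y).2) =
      (u : K) * (x.1 * y.1) + ((-u : Kˣ) : K) * (x.2 * y.2)
    simp only [e, LinearEquiv.coe_mk, LinearMap.coe_mk, AddHom.coe_mk, Units.val_one, Units.val_neg]
    field_simp
    ring
  rw [hyperbolic, unitForm, unitForm, unitForm, unitForm, ← map_add, ← map_add]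
  exact ofClass_mk_eq he

theorem hyperbolic_mul_unitForm [NeZero (2 : K)] (u : Kˣ) :
    hyperbolic K * unitForm u = hyperbolic K := by
  rw [hyperbolic, add_mul, ← unitForm_mul, ← unitForm_mul, one_mul, neg_one_mul,
    unitForm_add_unitForm_neg, hyperbolic]

theorem hyperbolic_mul_hyperbolic [NeZero (2 : K)] :
    hyperbolic K * hyperbolic K = 2 • hyperbolic K := by
  nth_rewrite 2 [hyperbolic]
  rw [mul_add, hyperbolic_mul_unitForm, hyperbolic_mul_unitForm, two_nsmul]

end GW

section Multiplicity

variable (K : Type u) [Field K] [CharZero K]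

theorem natUnit_one : natUnit K 1 = 1 := by
  ext; simp [natUnit]

theorem natUnit_mul (m n : ℕ+) : natUnit K (m * n) = natUnit K m * natUnit K n := by
  ext; simp [natUnit]

theorem natUnit_prod {ι : Type*} (s : Finset ι) (f : ι → ℕ+) :
    natUnit K (∏ i ∈ s, f i) = ∏ i ∈ s, natUnit K (f i) :=
  map_prod (⟨⟨natUnit K, natUnit_one K⟩, natUnit_mul K⟩ : ℕ+ →* Kˣ) f s

variable {K} in
theorem edgeMult_of_eq_two_mul {n : ℕ+} {q : ℕ} (h : (n : ℕ) = 2 * q) :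
    edgeMult K n = q • GW.hyperbolic K := by
  rw [edgeMult, if_neg (by rw [h]; simp), h, Nat.mul_div_cancel_left _ two_pos]

variable {K} in
theorem edgeMult_of_eq_two_mul_add_one {n : ℕ+} {q : ℕ} (h : (n : ℕ) = 2 * q + 1) :
    edgeMult K n = q • GW.hyperbolic K + GW.unitForm (natUnit K n) := by
  rw [edgeMult, if_pos ⟨q, h⟩, h, Nat.add_sub_cancel, Nat.mul_div_cancel_left _ two_pos]

theorem edgeMult_one : edgeMult K 1 = 1 := by
  rw [edgeMult_of_eq_two_mul_add_one (q := 0) rfl, zero_smul, zero_add, natUnit_one,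
    GW.unitForm_one]

theorem hyperbolic_mul_edgeMult (n : ℕ+) :
    GW.hyperbolic K * edgeMult K n = (n : ℕ) • GW.hyperbolic K := by
  obtain ⟨q, hq | hq⟩ := (n : ℕ).even_or_odd'
  · rw [edgeMult_of_eq_two_mul hq, mul_smul_comm, GW.hyperbolic_mul_hyperbolic, smul_smul, hq,
      mul_comm]
  · rw [edgeMult_of_eq_two_mul_add_one hq, mul_add, mul_smul_comm, GW.hyperbolic_mul_hyperbolic,
      GW.hyperbolic_mul_unitForm, smul_smul, hq, add_smul, one_smul, mul_comm]

theorem edgeMult_mul (m n : ℕ+) : edgeMult K (m * n) = edgeMult K m * edgeMult K n := by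
  obtain ⟨q, hq | hq⟩ := (m : ℕ).even_or_odd'
  · have h : ((m * n : ℕ+) : ℕ) = 2 * (q * n) := by rw [PNat.mul_coe, hq, mul_assoc]
    rw [edgeMult_of_eq_two_mul hq, edgeMult_of_eq_two_mul h, smul_mul_assoc,
      hyperbolic_mul_edgeMult, smul_smul]
  obtain ⟨r, hr | hr⟩ := (n : ℕ).even_or_odd'
  · have h : ((m * n : ℕ+) : ℕ) = 2 * (r * m) := by rw [PNat.mul_coe, hr]; ring
    rw [edgeMult_of_eq_two_mul hr, edgeMult_of_eq_two_mul h, mul_smul_comm,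
      mul_comm (edgeMult K m), hyperbolic_mul_edgeMult, smul_smul]
  · have h : ((m * n : ℕ+) : ℕ) = 2 * (q * n + r) + 1 := by rw [PNat.mul_coe, hq, hr]; ring
    rw [edgeMult_of_eq_two_mul_add_one hq, add_mul, smul_mul_assoc, hyperbolic_mul_edgeMult,
      edgeMult_of_eq_two_mul_add_one hr, edgeMult_of_eq_two_mul_add_one h, mul_add, mul_smul_comm,
      mul_comm (GW.unitForm _), GW.hyperbolic_mul_unitForm, ← GW.unitForm_mul, ← natUnit_mul,
      smul_smul, ← add_assoc, ← add_smul]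

theorem prod_map_edgeMult (s : Multiset ℕ+) : (s.map (edgeMult K)).prod = edgeMult K s.prod :=
  (map_multiset_prod (⟨⟨edgeMult K, edgeMult_one K⟩, edgeMult_mul K⟩ : ℕ+ →* GW K) s).symm

theorem edgeMult_eq (n : ℕ+) : edgeMult K n =
    ((n : ℕ) / 2) • GW.hyperbolic K + if Odd (n : ℕ) then GW.unitForm (natUnit K n) else 0 := by
  obtain ⟨q, hq | hq⟩ := (n : ℕ).even_or_odd'
  · rw [edgeMult_of_eq_two_mul hq, if_neg (by rw [hq]; simp), hq,
      Nat.mul_div_cancel_left _ two_pos, add_zero]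
  · rw [edgeMult_of_eq_two_mul_add_one hq, if_pos ⟨q, hq⟩, hq]
    congr 2
    omega

end Multiplicity

namespace FloorDiagram

variable {a lr ll : ℕ} (D : FloorDiagram a) (w : EndWeights lr ll)

theorem prod_markedWeights :
    (D.markedWeights w).prod = (D.edges.map fun e => e.weight).prod ^ 2 * ∏ x, w x := by
  rw [markedWeights, Multiset.prod_add, Multiset.prod_add, sq]
  rfl

theorem odd_prod_markedWeights_iff (hw : ∀ x, Odd (w x : ℕ)) :
    Odd ((D.markedWeights w).prod : ℕ) ↔ D.IsOdd := by
  have odd_prod_iff (s : Multiset ℕ+) : Odd (s.prod : ℕ) ↔ ∀ n ∈ s, Odd (n : ℕ) := by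
    induction s using Multiset.induction with
    | empty => simp
    | cons n s ih => simp [Nat.odd_mul, ih]
  simp only [odd_prod_iff, IsOdd, markedWeights, Multiset.mem_add, or_imp, forall_and,
    Multiset.forall_mem_map_iff, and_self]
  exact and_iff_left fun x _ => hw x

open Classical in
theorem mult_eq (K : Type u) [Field K] [CharZero K] (hw : ∀ x, Odd (w x : ℕ)) :
    D.mult K w = (((D.markedWeights w).prod : ℕ) / 2) • GW.hyperbolic K +
      if D.IsOdd then GW.unitForm ((∏ j, natUnit K (w (Sum.inl j))) *
        (∏ j, natUnit K (w (Sum.inr j)))) else 0 := by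
  have hsquare : GW.unitForm (natUnit K (D.markedWeights w).prod) =
      GW.unitForm ((∏ j, natUnit K (w (Sum.inl j))) * (∏ j, natUnit K (w (Sum.inr j)))) := by
    rw [prod_markedWeights, natUnit_mul, sq, natUnit_mul, ← sq, GW.unitForm_sq_mul, natUnit_prod,
      Fintype.prod_sum_type]
  rw [mult, prod_map_edgeMult, edgeMult_eq, hsquare]
  simp only [D.odd_prod_markedWeights_iff w hw]

open Classical in
theorem two_mul_prod_markedWeights_div_two (hw : ∀ x, Odd (w x : ℕ)) :
    (2 * (((D.markedWeights w).prod : ℕ) / 2 : ℕ) : ℚ) =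
      ((D.markedWeights w).prod : ℕ) - if D.IsOdd then 1 else 0 := by
  have h := Nat.div_add_mod ((D.markedWeights w).prod : ℕ) 2
  rw [eq_sub_iff_add_eq]
  split_ifs with hD
  · rw [Nat.odd_iff.1 ((D.odd_prod_markedWeights_iff w hw).2 hD)] at h
    exact_mod_cast h
  · rw [Nat.not_odd_iff.1 fun hP => hD ((D.odd_prod_markedWeights_iff w hw).1 hP)] at h
    exact_mod_cast h

end FloorDiagram

section PiecewisePolynomial

variable {ι : Type*} [Fintype ι]

/-- The affine-linear form with coefficients `t.1` and constant term `t.2`, as a function on the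
points with positive integral coordinates. -/
def affineForm : (ι → ℚ) × ℚ →ₗ[ℚ] (ι → ℕ+) → ℚ where
  toFun t x := ∑ i, t.1 i * ((x i : ℕ) : ℚ) + t.2
  map_add' t u := by ext x; simp [add_mul, Finset.sum_add_distrib]; ring
  map_smul' c t := by ext x; simp [mul_assoc, Finset.mul_sum, mul_add]

/-- The functions that agree on `S` with an affine-linear form. -/
def affineOn (S : Set (ι → ℕ+)) : Submodule ℚ ((ι → ℕ+) → ℚ) where
  carrier := {f | ∃ t, Set.EqOn f (affineForm t) S}
  add_mem' := fun ⟨t, ht⟩ ⟨u, hu⟩ =>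
    ⟨t + u, fun x hx => by simp only [map_add, Pi.add_apply, ht hx, hu hx]⟩
  zero_mem' := ⟨0, fun x _ => by rw [map_zero]⟩
  smul_mem' := fun c _ ⟨t, ht⟩ => ⟨c • t, fun x hx => by simp only [map_smul, Pi.smul_apply, ht hx]⟩

/-- The algebra of piecewise polynomial functions on `S`, see `IsPiecewisePolynomialOn`. The
families of affine-linear forms are taken to be finite sets, so that they are merged by unions. -/
def piecewisePolynomialOn (S : Set (ι → ℕ+)) : Subalgebra ℚ ((ι → ℕ+) → ℚ) where
  carrier := {f | ∃ T : Finset ((ι → ℚ) × ℚ), ∀ s : (ι → ℚ) × ℚ → SignType,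
    ∃ p : MvPolynomial ι ℚ, ∀ x ∈ S, (∀ t ∈ T, SignType.sign (affineForm t x) = s t) →
      f x = MvPolynomial.eval (fun i => ((x i : ℕ) : ℚ)) p}
  mul_mem' := by
    classical
    rintro f g ⟨T, hT⟩ ⟨U, hU⟩
    refine ⟨T ∪ U, fun s => ?_⟩
    obtain ⟨⟨p, hp⟩, q, hq⟩ := And.intro (hT s) (hU s)
    refine ⟨p * q, fun x hx hs => ?_⟩
    rw [map_mul, Pi.mul_apply, hp x hx fun t ht => hs t (Finset.mem_union_left U ht),
      hq x hx fun t ht => hs t (Finset.mem_union_right T ht)]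
  add_mem' := by
    classical
    rintro f g ⟨T, hT⟩ ⟨U, hU⟩
    refine ⟨T ∪ U, fun s => ?_⟩
    obtain ⟨⟨p, hp⟩, q, hq⟩ := And.intro (hT s) (hU s)
    refine ⟨p + q, fun x hx hs => ?_⟩
    rw [map_add, Pi.add_apply, hp x hx fun t ht => hs t (Finset.mem_union_left U ht),
      hq x hx fun t ht => hs t (Finset.mem_union_right T ht)]
  algebraMap_mem' c := ⟨∅, fun _ => ⟨MvPolynomial.C c, fun x _ _ => (MvPolynomial.eval_C c).symm⟩⟩

theorem IsPiecewisePolynomialOn.mono {S T : Set (ι → ℕ+)} {f : (ι → ℕ+) → ℤ}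
    (hf : IsPiecewisePolynomialOn T f) (h : S ⊆ T) : IsPiecewisePolynomialOn S f := by
  obtain ⟨m, A, B, hAB⟩ := hf
  refine ⟨m, A, B, fun s => ?_⟩
  obtain ⟨p, hp⟩ := hAB s
  exact ⟨p, fun x hx => hp x (h hx)⟩

variable {S : Set (ι → ℕ+)} {f g : (ι → ℕ+) → ℚ}

theorem isPiecewisePolynomialOn_of_mem {f : (ι → ℕ+) → ℤ}
    (hf : (fun x => (f x : ℚ)) ∈ piecewisePolynomialOn S) : IsPiecewisePolynomialOn S f := by
  classical
  obtain ⟨T, hT⟩ := hf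
  refine ⟨T.card, fun t => (T.equivFin.symm t).1.1, fun t => (T.equivFin.symm t).1.2, fun s => ?_⟩
  obtain ⟨p, hp⟩ := hT fun t => if ht : t ∈ T then s (T.equivFin ⟨t, ht⟩) else 0
  refine ⟨p, fun x hx hs => hp x hx fun t ht => ?_⟩
  simp only [dif_pos ht, ← hs, Equiv.symm_apply_apply]
  rfl

theorem coord_mem_affineOn (i : ι) : (fun x => ((x i : ℕ) : ℚ)) ∈ affineOn S := by
  classical
  exact ⟨(Pi.single i 1, 0), fun x _ => by simp [affineForm, Pi.single_apply]⟩

theorem const_mem_affineOn (c : ℚ) : (fun _ => c) ∈ affineOn S :=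
  ⟨(0, c), fun x _ => by simp [affineForm]⟩

theorem affineOn_congr (h : Set.EqOn f g S) (hg : g ∈ affineOn S) : f ∈ affineOn S :=
  hg.imp fun _ ht => h.trans ht

theorem piecewisePolynomialOn_congr (h : Set.EqOn f g S) (hg : g ∈ piecewisePolynomialOn S) :
    f ∈ piecewisePolynomialOn S := by
  obtain ⟨T, hT⟩ := hg
  refine ⟨T, fun s => ?_⟩
  obtain ⟨p, hp⟩ := hT s
  exact ⟨p, fun x hx hs => (h hx).trans (hp x hx hs)⟩

theorem const_mem_piecewisePolynomialOn (c : ℚ) : (fun _ => c) ∈ piecewisePolynomialOn S :=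
  (piecewisePolynomialOn S).algebraMap_mem c

theorem affineOn_le_piecewisePolynomialOn :
    affineOn S ≤ Subalgebra.toSubmodule (piecewisePolynomialOn S) := by
  rintro f ⟨t, ht⟩
  refine ⟨∅, fun _ => ⟨∑ i, MvPolynomial.C (t.1 i) * MvPolynomial.X i + MvPolynomial.C t.2,
    fun x hx _ => ?_⟩⟩
  simp [ht hx, affineForm]

theorem eval_mem_piecewisePolynomialOn {κ : Type*} {F : κ → (ι → ℕ+) → ℚ}
    (hF : ∀ j, F j ∈ piecewisePolynomialOn S) (q : MvPolynomial κ ℚ) :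
    (fun x => MvPolynomial.eval (fun j => F j x) q) ∈ piecewisePolynomialOn S := by
  induction q using MvPolynomial.induction_on with
  | C c => simpa only [MvPolynomial.eval_C] using const_mem_piecewisePolynomialOn c
  | add p q hp hq =>
    simp only [map_add]
    exact add_mem hp hq
  | mul_X p j hp =>
    simp only [map_mul, MvPolynomial.eval_X]
    exact mul_mem hp (hF j)

theorem comp_sign_mem_piecewisePolynomialOn {τ : Type*} [Finite τ] {F : τ → (ι → ℕ+) → ℚ}
    (hF : ∀ t, F t ∈ affineOn S) (h : (τ → SignType) → ℚ) :
    (fun x => h fun t => SignType.sign (F t x)) ∈ piecewisePolynomialOn S := by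
  classical
  have := Fintype.ofFinite τ
  choose A hA using hF
  refine ⟨Finset.univ.image A, fun s => ⟨MvPolynomial.C (h (s ∘ A)), fun x hx hs => ?_⟩⟩
  rw [MvPolynomial.eval_C]
  refine congrArg h (funext fun t => ?_)
  rw [hA t hx, hs _ (Finset.mem_image_of_mem A (Finset.mem_univ t)), Function.comp_apply]

theorem addMonoidHom_mem_affineOn {κ : Type*} [Finite κ] {d : (ι → ℕ+) → κ → ℤ}
    (hd : ∀ v, (fun w => (d w v : ℚ)) ∈ affineOn S) (φ : (κ → ℤ) →+ ℤ) :
    (fun w => (φ (d w) : ℚ)) ∈ affineOn S := by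
  classical
  have := Fintype.ofFinite κ
  have hφ : (fun w => (φ (d w) : ℚ)) =
      ∑ v, (φ (Pi.single v 1) : ℚ) • fun w => (d w v : ℚ) := by
    ext w
    have hsingle (v : κ) : Pi.single v (d w v) = d w v • (Pi.single v 1 : κ → ℤ) := by
      rw [← Pi.single_zsmul, smul_eq_mul, mul_one]
    conv_lhs => rw [← Finset.univ_sum_single (d w)]
    simp only [hsingle, map_sum, map_zsmul, Finset.sum_apply, Pi.smul_apply, smul_eq_mul,
      Int.cast_sum, Int.cast_mul, mul_comm]
  rw [hφ]
  exact sum_mem fun v _ => Submodule.smul_mem _ _ (hd v)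

end PiecewisePolynomial

section Antidifference

theorem exists_sub_map_eq_mul_pow {A : Type*} [CommRing A] [Algebra ℚ A] (T : A →ₐ[ℚ] A) {r t : A}
    (hr : T r = r) (ht : T t = t - 1) (n : ℕ) : ∃ Q, Q - T Q = r * t ^ n := by
  let B := Polynomial.bernoulli (n + 1)
  have hB : Polynomial.aeval (1 + t) B = Polynomial.aeval t B + ((n + 1 : ℕ) : ℚ) • t ^ n := by
    have := congrArg (Polynomial.aeval t) (Polynomial.bernoulli_comp_one_add_X (n + 1))
    simpa [Polynomial.aeval_comp, ← Nat.cast_smul_eq_nsmul ℚ] using this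
  have hT : T (Polynomial.aeval (1 + t) B) = Polynomial.aeval t B := by
    rw [← Polynomial.aeval_algHom_apply, map_add, map_one, ht, add_sub_cancel]
  refine ⟨((n + 1 : ℕ) : ℚ)⁻¹ • (r * Polynomial.aeval (1 + t) B), ?_⟩
  rw [map_smul, map_mul, hr, hT, hB, mul_add, ← smul_sub, add_sub_cancel_left, mul_smul_comm,
    inv_smul_smul₀ (Nat.cast_ne_zero.2 n.succ_ne_zero)]

theorem exists_sub_map_eq_of_adjoin_eq_top {A : Type*} [CommRing A] [Algebra ℚ A] (T : A →ₐ[ℚ] A)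
    {t : A} (ht : T t = t - 1)
    (h : Algebra.adjoin (AlgHom.equalizer T (AlgHom.id ℚ A)) {t} = ⊤) (q : A) :
    ∃ Q, Q - T Q = q := by
  obtain ⟨P, rfl⟩ : ∃ P : Polynomial (AlgHom.equalizer T (AlgHom.id ℚ A)),
      Polynomial.aeval t P = q := by
    rw [← AlgHom.mem_range, ← Algebra.adjoin_singleton_eq_range_aeval, h]
    trivial
  induction P using Polynomial.induction_on' with
  | add P P' hP hP' =>
    obtain ⟨⟨Q, hQ⟩, Q', hQ'⟩ := And.intro hP hP'
    exact ⟨Q + Q', by rw [map_add, map_add, add_sub_add_comm, hQ, hQ']⟩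
  | monomial n r =>
    obtain ⟨Q, hQ⟩ := exists_sub_map_eq_mul_pow T r.2 ht n
    exact ⟨Q, by rw [Polynomial.aeval_monomial]; exact hQ⟩

variable {κ : Type*} (δ : κ → ℚ)

/-- The algebra endomorphism `q(x) ↦ q(x - δ)` of the polynomial ring. -/
noncomputable def shiftBy : MvPolynomial κ ℚ →ₐ[ℚ] MvPolynomial κ ℚ :=
  MvPolynomial.bind₁ fun i => MvPolynomial.X i - MvPolynomial.C (δ i)

theorem eval_shiftBy (x : κ → ℚ) (q : MvPolynomial κ ℚ) :
    MvPolynomial.eval x (shiftBy δ q) = MvPolynomial.eval (x - δ) q := by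
  rw [shiftBy, MvPolynomial.eval, MvPolynomial.eval₂Hom_bind₁]
  simp
  rfl

variable {δ} in
theorem exists_sub_shiftBy_eq {e : κ} (he : δ e ≠ 0) (q : MvPolynomial κ ℚ) :
    ∃ Q, Q - shiftBy δ Q = q := by
  let t : MvPolynomial κ ℚ := MvPolynomial.C (δ e)⁻¹ * MvPolynomial.X e
  have shiftBy_X (f : κ) :
      shiftBy δ (MvPolynomial.X f) = MvPolynomial.X f - MvPolynomial.C (δ f) :=
    MvPolynomial.aeval_X _ f
  have shiftBy_C (c : ℚ) : shiftBy δ (MvPolynomial.C c) = MvPolynomial.C c :=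
    (shiftBy δ).commutes c
  have ht : shiftBy δ t = t - 1 := by
    rw [map_mul, shiftBy_C, shiftBy_X, mul_sub, ← map_mul, inv_mul_cancel₀ he, map_one]
  refine exists_sub_map_eq_of_adjoin_eq_top (shiftBy δ) ht (top_le_iff.1 fun p _ => ?_) q
  let Inv := AlgHom.equalizer (shiftBy δ) (AlgHom.id ℚ (MvPolynomial κ ℚ))
  have mem_of_invariant {r : MvPolynomial κ ℚ} (hr : shiftBy δ r = r) :
      r ∈ Algebra.adjoin Inv {t} := (Algebra.adjoin Inv {t}).algebraMap_mem ⟨r, hr⟩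
  induction p using MvPolynomial.induction_on with
  | C c => exact mem_of_invariant (shiftBy_C c)
  | add p p' hp hp' => exact add_mem (hp trivial) (hp' trivial)
  | mul_X p f hp =>
    have hf : shiftBy δ (MvPolynomial.X f - MvPolynomial.C (δ f) * t) =
        MvPolynomial.X f - MvPolynomial.C (δ f) * t := by
      rw [map_sub, map_mul, shiftBy_X, shiftBy_C, ht]
      ring
    rw [← sub_add_cancel (MvPolynomial.X f) (MvPolynomial.C (δ f) * t)]
    exact mul_mem (hp trivial) (add_mem (mem_of_invariant hf)
      (mul_mem (mem_of_invariant (shiftBy_C _)) (Algebra.self_mem_adjoin_singleton Inv t)))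

end Antidifference

section Flow

variable {V ε : Type*} [DecidableEq V] [Fintype ε] (src tgt : ε → V)

/-- The net inflow at the vertices of the graph with edges `src e → tgt e` carrying the flow
`x e`. -/
def netFlow : (ε → ℤ) →+ (V → ℤ) where
  toFun x v := ∑ e, x e * ((if tgt e = v then 1 else 0) - if src e = v then 1 else 0)
  map_zero' := by ext v; simp
  map_add' x y := by ext v; simp [add_mul, Finset.sum_add_distrib]

theorem netFlow_single [DecidableEq ε] (e : ε) (c : ℤ) :
    netFlow src tgt (Pi.single e c) = Pi.single (tgt e) c - Pi.single (src e) c := by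
  ext v
  rw [netFlow, AddMonoidHom.coe_mk, ZeroHom.coe_mk,
    Fintype.sum_eq_single e fun f hf => by rw [Pi.single_eq_of_ne hf, zero_mul]]
  simp [Pi.single_apply, mul_sub, eq_comm]

theorem sum_mul_netFlow [Fintype V] (h : V → ℤ) (x : ε → ℤ) :
    ∑ v, h v * netFlow src tgt x v = ∑ e, x e * (h (tgt e) - h (src e)) := by
  simp only [netFlow, AddMonoidHom.coe_mk, ZeroHom.coe_mk, Finset.mul_sum]
  rw [Finset.sum_comm]
  refine Finset.sum_congr rfl fun e _ => ?_
  rw [mul_sub, mul_comm (x e), mul_comm (x e)]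
  simp only [mul_sub, Finset.sum_sub_distrib, mul_ite, mul_one, mul_zero, Finset.sum_ite_eq,
    Finset.mem_univ, if_true]

theorem exists_apply_netFlow_eq [Finite V] [DecidableEq ε] {E : Finset ε} {e : ε}
    (h : ∀ x : ε → ℤ, (∀ f ∉ E.erase e, x f = 0) →
      netFlow src tgt x ≠ Pi.single (src e) 1 - Pi.single (tgt e) 1) :
    ∃ ψ : (V → ℤ) →+ ℤ, ∀ x : ε → ℤ, (∀ f ∉ E, x f = 0) → ψ (netFlow src tgt x) = x e := by
  classical
  have := Fintype.ofFinite V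
  let L : AddSubgroup (V → ℤ) :=
    (AddSubgroup.pi ((E.erase e : Finset ε) : Set ε)ᶜ fun _ => ⊥).map (netFlow src tgt)
  have single_sub_single_mem {f : ε} (hf : f ∈ E.erase e) :
      Pi.single (tgt f) 1 - Pi.single (src f) 1 ∈ L := by
    refine ⟨Pi.single f 1, fun f' hf' => ?_, netFlow_single src tgt f 1⟩
    exact Pi.single_eq_of_ne (fun h : f' = f => hf' (h ▸ hf)) _
  -- `χ` is the indicator function of the component of `tgt e` after the removal of the edge `e`.
  let χ : V → ℤ := fun v => if Pi.single v 1 - Pi.single (tgt e) 1 ∈ L then 1 else 0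
  have hχ {f : ε} (hf : f ∈ E.erase e) : χ (tgt f) = χ (src f) := by
    refine if_congr ?_ rfl rfl
    rw [← sub_add_sub_cancel (Pi.single (tgt f) 1) (Pi.single (src f) 1),
      L.add_mem_cancel_left (single_sub_single_mem hf)]
  have hχ_tgt : χ (tgt e) = 1 := if_pos (by rw [sub_self]; exact L.zero_mem)
  have hχ_src : χ (src e) = 0 := if_neg fun ⟨x, hx, hxe⟩ => h x (fun f hf => hx f hf) hxe
  refine ⟨∑ v, (AddMonoidHom.mulLeft (χ v)).comp (Pi.evalAddMonoidHom _ v), fun x hx => ?_⟩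
  simp only [AddMonoidHom.finsetSum_apply, AddMonoidHom.comp_apply, AddMonoidHom.coe_mulLeft,
    Pi.evalAddMonoidHom_apply]
  rw [sum_mul_netFlow, Fintype.sum_eq_single e fun f hfe => ?_, hχ_tgt, hχ_src, sub_zero, mul_one]
  by_cases hf : f ∈ E
  · rw [hχ (Finset.mem_erase.2 ⟨hfe, hf⟩), sub_self, mul_zero]
  · rw [hx f hf, zero_mul]

theorem exists_circulation_or_leftInverse [Finite V] (E : Finset ε) :
    (∃ δ : ε → ℤ, (∀ f ∉ E, δ f = 0) ∧ netFlow src tgt δ = 0 ∧ ∃ e, δ e ≠ 0) ∨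
      ∃ φ : (V → ℤ) →+ (ε → ℤ),
        ∀ x : ε → ℤ, (∀ f ∉ E, x f = 0) → φ (netFlow src tgt x) = x := by
  classical
  by_cases h : ∃ e ∈ E, ∃ x : ε → ℤ, (∀ f ∉ E.erase e, x f = 0) ∧
      netFlow src tgt x = Pi.single (src e) 1 - Pi.single (tgt e) 1
  · obtain ⟨e, he, x, hx, hxe⟩ := h
    refine .inl ⟨x + Pi.single e 1, fun f hf => ?_, ?_, e, ?_⟩
    · have hfe : f ≠ e := fun h => hf (h ▸ he)
      rw [Pi.add_apply, hx f fun h => hf (Finset.mem_of_mem_erase h), Pi.single_eq_of_ne hfe,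
        add_zero]
    · rw [map_add, hxe, netFlow_single, sub_add_sub_cancel, sub_self]
    · rw [Pi.add_apply, hx e (Finset.notMem_erase e E), Pi.single_eq_same, zero_add]
      exact one_ne_zero
  · push Not at h
    have hψ (e : ε) : ∃ ψ : (V → ℤ) →+ ℤ, ∀ x : ε → ℤ, (∀ f ∉ E, x f = 0) →
        ψ (netFlow src tgt x) = x e := by
      by_cases he : e ∈ E
      · exact exists_apply_netFlow_eq src tgt (h e he)
      · exact ⟨0, fun x hx => (hx e he).symm⟩
    choose ψ hψ using hψ
    exact .inr ⟨AddMonoidHom.pi ψ, fun x hx => funext fun e => hψ e x hx⟩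

/-- The integral flows with net inflow `d` that are bounded below by `c` on `E` and agree with `c`
outside `E`. -/
def flowFiber (E : Finset ε) (c : ε → ℤ) (d : V → ℤ) : Set (ε → ℤ) :=
  {x | (∀ e ∈ E, c e ≤ x e) ∧ (∀ e ∉ E, x e = c e) ∧ netFlow src tgt x = d}

/-- The sum of the values of a polynomial at the flows of a fibre. -/
noncomputable def flowSum (E : Finset ε) (c : ε → ℤ) (d : V → ℤ) (q : MvPolynomial ε ℚ) : ℚ :=
  ∑ᶠ x ∈ flowFiber src tgt E c d, MvPolynomial.eval (fun e => (x e : ℚ)) q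

variable {src tgt}

theorem finite_flowFiber [Finite V] {h : V → ℤ} (hh : ∀ e, h (src e) < h (tgt e)) (E : Finset ε)
    (c : ε → ℤ) (d : V → ℤ) : (flowFiber src tgt E c d).Finite := by
  classical
  have := Fintype.ofFinite V
  let B : ℤ := ∑ v, h v * (d v - netFlow src tgt c v)
  refine (Set.finite_Icc c (fun e => c e + B)).subset fun x ⟨hE, hE', hd⟩ => ?_
  have hcx (e : ε) : c e ≤ x e := by
    by_cases he : e ∈ E
    exacts [hE e he, (hE' e he).ge]
  refine ⟨hcx, fun e => sub_le_iff_le_add'.1 ?_⟩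
  calc x e - c e
      ≤ (x e - c e) * (h (tgt e) - h (src e)) :=
        le_mul_of_one_le_right (sub_nonneg.2 (hcx e)) (by linarith [hh e])
    _ ≤ ∑ f, (x - c) f * (h (tgt f) - h (src f)) :=
        Finset.single_le_sum (f := fun f => (x - c) f * (h (tgt f) - h (src f)))
          (fun f _ => mul_nonneg (sub_nonneg.2 (hcx f)) (sub_nonneg.2 (hh f).le))
          (Finset.mem_univ e)
    _ = B := by rw [← sum_mul_netFlow, map_sub, hd]; rfl

theorem flowSum_shiftBy {δ : ε → ℤ}
    (hδ : netFlow src tgt δ = 0) (E : Finset ε) (c : ε → ℤ) (d : V → ℤ)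
    (q : MvPolynomial ε ℚ) :
    flowSum src tgt E c d (shiftBy (fun e => (δ e : ℚ)) q) = flowSum src tgt E (c - δ) d q := by
  refine finsum_mem_eq_of_bijOn (· - δ) (Set.BijOn.mk ?_ (sub_left_injective.injOn) ?_) ?_
  · rintro x ⟨h1, h2, h3⟩
    exact ⟨fun e he => sub_le_sub_right (h1 e he) _, fun e he => congrArg (· - δ e) (h2 e he),
      by rw [map_sub, h3, hδ, sub_zero]⟩
  · rintro x ⟨h1, h2, h3⟩
    refine ⟨x + δ, ⟨fun e he => sub_le_iff_le_add.1 (h1 e he), fun e he => ?_,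
      by rw [map_add, h3, hδ, add_zero]⟩, add_sub_cancel_right x δ⟩
    rw [Pi.add_apply, h2 e he, Pi.sub_apply, sub_add_cancel]
  · intro x _
    rw [eval_shiftBy]
    congr 2
    ext e
    simp

theorem flowSum_sub_flowSum_sub [Finite V] {h : V → ℤ} (hh : ∀ e, h (src e) < h (tgt e))
    {δ : ε → ℤ} (hδ : netFlow src tgt δ = 0) (E : Finset ε) (c : ε → ℤ) (d : V → ℤ)
    (q : MvPolynomial ε ℚ) :
    flowSum src tgt E c d q - flowSum src tgt E (c - δ) d q =
      flowSum src tgt E c d (q - shiftBy (fun e => (δ e : ℚ)) q) := by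
  rw [← flowSum_shiftBy hδ]
  simp only [flowSum, map_sub]
  exact (finsum_mem_sub_distrib _ _ (finite_flowFiber hh E c d)).symm

theorem flowFiber_eq_union [DecidableEq ε] {E : Finset ε} {j : ε} (hj : j ∈ E) (c : ε → ℤ)
    (d : V → ℤ) :
    flowFiber src tgt E c d =
      flowFiber src tgt (E.erase j) c d ∪ flowFiber src tgt E (c + Pi.single j 1) d := by
  ext x
  constructor
  · rintro ⟨hE, hE', hd⟩
    rcases (hE j hj).eq_or_lt with hxj | hxj
    · refine .inl ⟨fun e he => hE e (Finset.mem_of_mem_erase he), fun e he => ?_, hd⟩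
      rcases eq_or_ne e j with rfl | hej
      exacts [hxj.symm, hE' e fun h => he (Finset.mem_erase.2 ⟨hej, h⟩)]
    · refine .inr ⟨fun e he => ?_, fun e he => ?_, hd⟩
      · rcases eq_or_ne e j with rfl | hej
        · simpa using hxj
        · simpa [hej] using hE e he
      · simpa [show e ≠ j from fun h => he (h ▸ hj)] using hE' e he
  · rintro (⟨hE, hE', hd⟩ | ⟨hE, hE', hd⟩)
    · refine ⟨fun e he => ?_, fun e he => hE' e fun h => he (Finset.mem_of_mem_erase h), hd⟩
      rcases eq_or_ne e j with rfl | hej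
      exacts [(hE' e (Finset.notMem_erase e E)).ge, hE e (Finset.mem_erase.2 ⟨hej, he⟩)]
    · refine ⟨fun e he => le_trans ?_ (hE e he), fun e he => ?_, hd⟩
      · exact le_add_of_nonneg_right ((Pi.single_nonneg (α := fun _ : ε => ℤ)).2 zero_le_one e)
      · simpa [show e ≠ j from fun h => he (h ▸ hj)] using hE' e he

theorem flowSum_eq_add [Finite V] [DecidableEq ε] {h : V → ℤ}
    (hh : ∀ e, h (src e) < h (tgt e)) {E : Finset ε} {j : ε} (hj : j ∈ E) (c : ε → ℤ)
    (d : V → ℤ) (q : MvPolynomial ε ℚ) :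
    flowSum src tgt E c d q =
      flowSum src tgt (E.erase j) c d q + flowSum src tgt E (c + Pi.single j 1) d q := by
  rw [flowSum, flowFiber_eq_union hj, finsum_mem_union _ (finite_flowFiber hh _ _ _)
    (finite_flowFiber hh _ _ _), flowSum, flowSum]
  refine Set.disjoint_left.2 fun x hx hx' => ?_
  have hxj : x j = c j := hx.2.1 j (Finset.notMem_erase j E)
  have hxj' : c j + 1 ≤ x j := by simpa using hx'.1 j hj
  omega

variable [Finite V] {ι : Type*} [Fintype ι] {S : Set (ι → ℕ+)} {d : (ι → ℕ+) → V → ℤ}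

theorem flowSum_mem_of_leftInverse (hd : ∀ v, (fun w => (d w v : ℚ)) ∈ affineOn S) {E : Finset ε}
    {φ : (V → ℤ) →+ (ε → ℤ)} (hφ : ∀ x : ε → ℤ, (∀ f ∉ E, x f = 0) → φ (netFlow src tgt x) = x)
    (c : ε → ℤ) (q : MvPolynomial ε ℚ) :
    (fun w => flowSum src tgt E c (d w) q) ∈ piecewisePolynomialOn S := by
  classical
  let d' (w : ι → ℕ+) : V → ℤ := d w - netFlow src tgt c
  have hd' (v : V) : (fun w => (d' w v : ℚ)) ∈ affineOn S := by
    simp only [d', Pi.sub_apply, Int.cast_sub]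
    exact sub_mem (hd v) (const_mem_affineOn _)
  -- The only candidate for an element of the fibre is `c + φ (d' w)`.
  have hsub (w : ι → ℕ+) {x : ε → ℤ} (hx : x ∈ flowFiber src tgt E c (d w)) :
      x = c + φ (d' w) := by
    rw [← sub_eq_iff_eq_add', ← hφ (x - c) fun f hf => sub_eq_zero.2 (hx.2.1 f hf), map_sub, hx.2.2]
  -- Whether it does belong to the fibre depends on the signs of these linear forms at `d' w`.
  let Φ : ε ⊕ V → (V → ℤ) →+ ℤ :=
    Sum.elim (fun e => (Pi.evalAddMonoidHom _ e).comp φ)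
      fun v => (Pi.evalAddMonoidHom _ v).comp ((netFlow src tgt).comp φ - AddMonoidHom.id _)
  let InFiber (s : ε ⊕ V → SignType) : Prop :=
    (∀ e ∈ E, 0 ≤ s (.inl e)) ∧ (∀ e ∉ E, s (.inl e) = 0) ∧ ∀ v, s (.inr v) = 0
  have hmem (w : ι → ℕ+) : c + φ (d' w) ∈ flowFiber src tgt E c (d w) ↔
      InFiber fun t => SignType.sign ((Φ t (d' w) : ℤ) : ℚ) := by
    simp only [InFiber, sign_nonneg_iff, sign_eq_zero_iff, Int.cast_nonneg_iff, Int.cast_eq_zero]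
    simp [flowFiber, Φ, d', funext_iff, sub_eq_zero, eq_sub_iff_add_eq']
  have hsum (w : ι → ℕ+) : flowSum src tgt E c (d w) q =
      (if InFiber fun t => SignType.sign ((Φ t (d' w) : ℤ) : ℚ) then 1 else 0) *
        MvPolynomial.eval (fun e => (c e : ℚ) + (φ (d' w) e : ℚ)) q := by
    rw [flowSum]
    split_ifs with h
    · rw [(Set.eq_singleton_iff_unique_mem.2 ⟨(hmem w).2 h, fun x hx => hsub w hx⟩),
        finsum_mem_singleton, one_mul]
      simp
    · rw [Set.eq_empty_iff_forall_notMem.2 fun x hx => h ((hmem w).1 (hsub w hx ▸ hx)),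
        finsum_mem_empty, zero_mul]
  simp only [hsum]
  refine mul_mem (comp_sign_mem_piecewisePolynomialOn
    (fun t => addMonoidHom_mem_affineOn hd' (Φ t)) fun s => if InFiber s then 1 else 0) ?_
  exact eval_mem_piecewisePolynomialOn (fun e => affineOn_le_piecewisePolynomialOn (add_mem
    (const_mem_affineOn _) (addMonoidHom_mem_affineOn hd' (Φ (.inl e))))) q

theorem flowSum_add_sub_flowSum_mem [DecidableEq ε] {h : V → ℤ}
    (hh : ∀ e, h (src e) < h (tgt e)) {E : Finset ε} {q : MvPolynomial ε ℚ} (hE : ∀ j ∈ E, ∀ c,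
      (fun w => flowSum src tgt (E.erase j) c (d w) q) ∈ piecewisePolynomialOn S)
    {u : ε → ℤ} (hu : ∀ e ∉ E, u e = 0) (c : ε → ℤ) :
    (fun w => flowSum src tgt E (c + u) (d w) q - flowSum src tgt E c (d w) q) ∈
      piecewisePolynomialOn S := by
  let U : AddSubgroup (ε → ℤ) :=
    { carrier := {u | ∀ c, (fun w => flowSum src tgt E (c + u) (d w) q -
        flowSum src tgt E c (d w) q) ∈ piecewisePolynomialOn S}
      add_mem' := fun {u u'} hu hu' c => by
        have := add_mem (hu' (c + u)) (hu c)
        simpa only [Pi.add_def, sub_add_sub_cancel, add_assoc] using this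
      zero_mem' := fun c => by
        simpa only [add_zero, sub_self] using const_mem_piecewisePolynomialOn 0
      neg_mem' := fun {u} hu c => by
        obtain ⟨c, rfl⟩ : ∃ c', c = c' + u := ⟨c - u, (sub_add_cancel c u).symm⟩
        convert neg_mem (hu c) using 2 with w
        rw [add_neg_cancel_right]
        exact (neg_sub _ _).symm }
  have single_mem {j : ε} (hj : j ∈ E) : Pi.single j 1 ∈ U := fun c => by
    convert neg_mem (hE j hj c) using 2 with w
    rw [flowSum_eq_add hh hj c]
    exact sub_add_cancel_right _ _
  suffices u ∈ U from this c
  rw [← Finset.univ_sum_single u]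
  refine sum_mem fun e _ => ?_
  by_cases he : e ∈ E
  · rw [← mul_one (u e), ← smul_eq_mul, Pi.single_zsmul]
    exact U.zsmul_mem (single_mem he) (u e)
  · rw [hu e he, Pi.single_zero]
    exact U.zero_mem

theorem flowSum_mem_piecewisePolynomialOn {h : V → ℤ} (hh : ∀ e, h (src e) < h (tgt e))
    (hd : ∀ v, (fun w => (d w v : ℚ)) ∈ affineOn S) (E : Finset ε) (c : ε → ℤ)
    (q : MvPolynomial ε ℚ) :
    (fun w => flowSum src tgt E c (d w) q) ∈ piecewisePolynomialOn S := by
  classical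
  induction E using Finset.strongInduction generalizing c q with
  | H E ih =>
    obtain ⟨δ, hδE, hδ, e, he⟩ | ⟨φ, hφ⟩ := exists_circulation_or_leftInverse src tgt E
    · obtain ⟨Q, rfl⟩ := exists_sub_shiftBy_eq (δ := fun e => (δ e : ℚ)) (Int.cast_ne_zero.2 he) q
      simp only [← flowSum_sub_flowSum_sub hh hδ]
      have := flowSum_add_sub_flowSum_mem hh
        (fun j hj c => ih (E.erase j) (Finset.erase_ssubset hj) c Q) hδE (c - δ)
      simpa only [sub_add_cancel] using this
    · exact flowSum_mem_of_leftInverse hd hφ c q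

end Flow

section PositiveFlow

theorem coe_toPNat'_toNat_add_one {n : ℤ} (hn : 0 ≤ n) :
    (((n + 1).toNat.toPNat' : ℕ) : ℤ) = n + 1 := by
  rw [Nat.toPNat'_coe, if_pos (by omega), Int.toNat_of_nonneg (by omega)]

theorem exists_coe_eq_nsmul_add_one {ε : Type*} {s : ℕ} (hs : 0 < s) {y : ε → ℕ+}
    (hy : ∀ e, (y e : ℕ) ≡ 1 [MOD s]) :
    ∃ z : ε → ℤ, (∀ e, 0 ≤ z e) ∧ (fun e => ((y e : ℕ) : ℤ)) = s • z + 1 := by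
  have hz (e : ε) : ∃ z : ℤ, ((y e : ℕ) : ℤ) - 1 = s * z :=
    (Int.natCast_modEq_iff.2 (hy e)).symm.dvd
  choose z hz using hz
  refine ⟨z, fun e => (mul_nonneg_iff_of_pos_left (Nat.cast_pos.2 hs)).1 ?_,
    funext fun e => by simp [← hz]⟩
  rw [← hz e, sub_nonneg]
  exact Nat.one_le_cast.2 (y e).pos

variable {V ε : Type*} [DecidableEq V] [Fintype ε]

/-- The flows with net inflow `d` whose values are positive integers congruent to `1` modulo `s`.
For `s = 1` the congruence is void, for `s = 2` it says that the values are odd. -/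
def positiveFlows (src tgt : ε → V) (s : ℕ) (d : V → ℤ) : Set (ε → ℕ+) :=
  {y | (∀ e, (y e : ℕ) ≡ 1 [MOD s]) ∧ netFlow src tgt (fun e => (y e : ℕ)) = d}

variable {src tgt : ε → V}

theorem finite_positiveFlows [Finite V] {h : V → ℤ} (hh : ∀ e, h (src e) < h (tgt e)) (s : ℕ)
    (d : V → ℤ) : (positiveFlows src tgt s d).Finite := by
  refine ((finite_flowFiber hh Finset.univ 1 d).preimage
    (f := fun (y : ε → ℕ+) e => ((y e : ℕ) : ℤ))
    fun y _ y' _ hy => funext fun e => ?_).subset fun y hy => ⟨fun e _ => ?_, by simp, hy.2⟩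
  · exact PNat.coe_injective (Nat.cast_injective (congrFun hy e))
  · exact Nat.one_le_cast.2 (y e).pos

theorem bijOn_positiveFlows {s : ℕ} (hs : 0 < s) (d : V → ℤ) :
    Set.BijOn (fun (z : ε → ℤ) e => (s * z e + 1).toNat.toPNat')
      (flowFiber src tgt Finset.univ 0 d)
      (positiveFlows src tgt s (s • d + netFlow src tgt 1)) := by
  have coe_eq {z : ε → ℤ} (hz : ∀ e, 0 ≤ z e) :
      (fun e => (((s * z e + 1).toNat.toPNat' : ℕ) : ℤ)) = s • z + 1 := by
    ext e
    rw [coe_toPNat'_toNat_add_one (mul_nonneg s.cast_nonneg (hz e))]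
    simp
  have nonneg {z : ε → ℤ} (hz : z ∈ flowFiber src tgt Finset.univ 0 d) (e : ε) : 0 ≤ z e :=
    hz.1 e (Finset.mem_univ e)
  refine ⟨fun z hz => ⟨fun e => ?_, ?_⟩, fun z hz z' hz' h => ?_, fun y ⟨hy, hyd⟩ => ?_⟩
  · rw [← Int.natCast_modEq_iff, congrFun (coe_eq (nonneg hz)) e, Int.modEq_comm,
      Int.modEq_iff_dvd]
    simp
  · rw [coe_eq (nonneg hz), map_add, map_nsmul, hz.2.2]
  · have hzz' : s • z + 1 = s • z' + 1 := by
      rw [← coe_eq (nonneg hz), ← coe_eq (nonneg hz')]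
      exact congrArg (fun (y : ε → ℕ+) e => ((y e : ℕ) : ℤ)) h
    exact nsmul_right_injective hs.ne' (add_left_injective 1 hzz')
  · obtain ⟨z, hz, hyz⟩ := exists_coe_eq_nsmul_add_one hs hy
    refine ⟨z, ⟨fun e _ => hz e, by simp, nsmul_right_injective hs.ne' ?_⟩, funext fun e =>
      PNat.eq (Nat.cast_injective ((congrFun (coe_eq hz) e).trans (congrFun hyz e).symm))⟩
    rw [hyz, map_add, map_nsmul] at hyd
    exact add_right_cancel hyd

theorem finsum_positiveFlows {s : ℕ} (hs : 0 < s) (d : V → ℤ) (q : MvPolynomial ε ℚ) :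
    ∑ᶠ y ∈ positiveFlows src tgt s (s • d + netFlow src tgt 1),
        MvPolynomial.eval (fun e => ((y e : ℕ) : ℚ)) q =
      flowSum src tgt Finset.univ 0 d
        (MvPolynomial.bind₁ (fun e => (s : ℚ) • MvPolynomial.X e + 1) q) := by
  refine (finsum_mem_eq_of_bijOn _ (bijOn_positiveFlows hs d) fun z hz => ?_).symm
  rw [MvPolynomial.eval, MvPolynomial.eval, MvPolynomial.eval₂Hom_bind₁]
  congr 2
  ext e
  dsimp only
  rw [← Int.cast_natCast (PNat.val _), coe_toPNat'_toNat_add_one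
    (mul_nonneg s.cast_nonneg (hz.1 e (Finset.mem_univ e)))]
  simp

theorem finsum_positiveFlows_mem_piecewisePolynomialOn [Finite V] {h : V → ℤ}
    (hh : ∀ e, h (src e) < h (tgt e)) {ι : Type*} [Fintype ι] {S : Set (ι → ℕ+)}
    {d : (ι → ℕ+) → V → ℤ} (hd : ∀ v, (fun w => (d w v : ℚ)) ∈ affineOn S) {s : ℕ} (hs : 0 < s)
    (hds : ∀ w ∈ S, ∀ w' ∈ S, ∀ v, d w v ≡ d w' v [ZMOD s]) (q : MvPolynomial ε ℚ) :
    (fun w => ∑ᶠ y ∈ positiveFlows src tgt s (d w),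
      MvPolynomial.eval (fun e => ((y e : ℕ) : ℚ)) q) ∈ piecewisePolynomialOn S := by
  classical
  by_cases hS : ∃ w ∈ S, (positiveFlows src tgt s (d w)).Nonempty
  · obtain ⟨w₀, hw₀, y, hy, hyd⟩ := hS
    obtain ⟨z, -, hz⟩ := exists_coe_eq_nsmul_add_one hs hy
    rw [hz, map_add, map_nsmul] at hyd
    have hdvd (w) (hw : w ∈ S) (v : V) : (s : ℤ) ∣ d w v - netFlow src tgt 1 v := by
      rw [← Int.modEq_iff_dvd]
      refine Int.ModEq.trans ?_ (hds w₀ hw₀ w hw v)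
      simp [← hyd, Int.modEq_iff_dvd]
    let d' (w : ι → ℕ+) (v : V) : ℤ := (d w v - netFlow src tgt 1 v) / s
    have hd'd (w) (hw : w ∈ S) : d w = s • d' w + netFlow src tgt 1 := by
      ext v
      simp [d', Int.mul_ediv_cancel' (hdvd w hw v)]
    have hd' (v : V) : (fun w => (d' w v : ℚ)) ∈ affineOn S := by
      refine affineOn_congr (fun w hw => ?_) (Submodule.smul_mem _ (s : ℚ)⁻¹
        (sub_mem (hd v) (const_mem_affineOn (netFlow src tgt 1 v : ℚ))))
      simp [hd'd w hw, hs.ne']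
    refine piecewisePolynomialOn_congr (fun w hw => ?_)
      (flowSum_mem_piecewisePolynomialOn hh hd' Finset.univ 0
        (MvPolynomial.bind₁ (fun e => (s : ℚ) • MvPolynomial.X e + 1) q))
    rw [hd'd w hw, finsum_positiveFlows hs]
  · push Not at hS
    refine piecewisePolynomialOn_congr (fun w hw => ?_) (const_mem_piecewisePolynomialOn 0)
    rw [hS w hw, finsum_mem_empty]

end PositiveFlow

namespace FloorDiagram

variable {a lr ll k : ℕ} {D : FloorDiagram a} {w : EndWeights lr ll}

/-- The vertices of a marked floor diagram, for a labelling of the edges of `D` by `T`. -/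
def MarkedVertex.sumEquiv {T : Type*} (β : T ≃ D.edges.ToType) :
    Fin a ⊕ T ⊕ Fin lr ⊕ Fin ll ≃ D.MarkedVertex lr ll where
  toFun
    | .inl v => .white v
    | .inr (.inl t) => .edge (β t)
    | .inr (.inr (.inl j)) => .right j
    | .inr (.inr (.inr i)) => .left i
  invFun
    | .white v => .inl v
    | .edge e => .inr (.inl (β.symm e))
    | .right j => .inr (.inr (.inl j))
    | .left i => .inr (.inr (.inr i))
  left_inv := by rintro (v | t | j | i) <;> simp
  right_inv := by rintro (v | e | j | i) <;> simp

instance : Finite (D.MarkedVertex lr ll) := .of_equiv _ (MarkedVertex.sumEquiv (Equiv.refl _))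

/-- A relabelling of the edges of `D` and of the right and left ends that preserves the weights
(and the end points of the edges of `D`). The equivalences of markings are induced by these. -/
@[ext]
structure WeightPerm (D : FloorDiagram a) (w : EndWeights lr ll) where
  edge : Equiv.Perm D.edges.ToType
  right : Equiv.Perm (Fin lr)
  left : Equiv.Perm (Fin ll)
  val_edge : ∀ e, (edge e).1 = e.1
  weight_right : ∀ j, w (.inl (right j)) = w (.inl j)
  weight_left : ∀ i, w (.inr (left i)) = w (.inr i)

namespace WeightPerm

/-- The inverse relabelling. -/
def symm (γ : D.WeightPerm w) : D.WeightPerm w where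
  edge := γ.edge.symm
  right := γ.right.symm
  left := γ.left.symm
  val_edge e := by rw [← γ.val_edge, Equiv.apply_symm_apply]
  weight_right j := by rw [← γ.weight_right, Equiv.apply_symm_apply]
  weight_left i := by rw [← γ.weight_left, Equiv.apply_symm_apply]

/-- The permutation of the vertices of the marked floor diagrams given by a relabelling. -/
def perm (γ : D.WeightPerm w) : Equiv.Perm (D.MarkedVertex lr ll) :=
  (MarkedVertex.sumEquiv (Equiv.refl _)).permCongr
    ((Equiv.refl _).sumCongr (γ.edge.sumCongr (γ.right.sumCongr γ.left)))

theorem perm_injective : Function.Injective (perm : D.WeightPerm w → _) := fun _ _ h =>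
  WeightPerm.ext (Equiv.ext fun e => MarkedVertex.edge.inj (DFunLike.congr_fun h (.edge e)))
    (Equiv.ext fun j => MarkedVertex.right.inj (DFunLike.congr_fun h (.right j)))
    (Equiv.ext fun i => MarkedVertex.left.inj (DFunLike.congr_fun h (.left i)))

end WeightPerm

section MarkedArc

variable {ρ ρ' : Fin lr → Fin a} {l l' : Fin ll → Fin a} {x y : D.MarkedVertex lr ll} {n : ℕ+}

theorem MarkedArc.map_perm (h : D.MarkedArc w ρ l x y n) (γ : D.WeightPerm w) :
    D.MarkedArc w (ρ ∘ γ.right.symm) (l ∘ γ.left.symm) (γ.perm x) (γ.perm y) n := by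
  cases h with
  | firstHalf e => exact γ.val_edge e ▸ .firstHalf (γ.edge e)
  | secondHalf e => exact γ.val_edge e ▸ .secondHalf (γ.edge e)
  | right j =>
    have := MarkedArc.right (D := D) (w := w) (rightSrc := ρ ∘ γ.right.symm)
      (leftTgt := l ∘ γ.left.symm) (γ.right j)
    rwa [γ.weight_right, Function.comp_apply, Equiv.symm_apply_apply] at this
  | left i =>
    have := MarkedArc.left (D := D) (w := w) (rightSrc := ρ ∘ γ.right.symm)
      (leftTgt := l ∘ γ.left.symm) (γ.left i)
    rwa [γ.weight_left, Function.comp_apply, Equiv.symm_apply_apply] at this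

theorem markedArc_perm_iff (γ : D.WeightPerm w) :
    D.MarkedArc w ρ l x y n ↔
      D.MarkedArc w (ρ ∘ γ.right.symm) (l ∘ γ.left.symm) (γ.perm x) (γ.perm y) n := by
  refine ⟨fun h => h.map_perm γ, fun h => ?_⟩
  have hsymm (z : D.MarkedVertex lr ll) : γ.symm.perm (γ.perm z) = z := γ.perm.symm_apply_apply z
  have hright : γ.right.symm ∘ γ.symm.right.symm = id := funext γ.right.symm_apply_apply
  have hleft : γ.left.symm ∘ γ.symm.left.symm = id := funext γ.left.symm_apply_apply
  simpa only [hsymm, Function.comp_assoc, hright, hleft, Function.comp_id] using h.map_perm γ.symm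

theorem MarkedArc.of_white_left {v : Fin a} (h : D.MarkedArc w ρ l (.white v) x n) :
    (∃ e : D.edges.ToType, x = .edge e ∧ e.1.src = v ∧ e.1.weight = n) ∨
      ∃ j, x = .right j ∧ ρ j = v ∧ w (.inl j) = n := by
  cases h with
  | firstHalf e => exact .inl ⟨e, rfl, rfl, rfl⟩
  | right j => exact .inr ⟨j, rfl, rfl, rfl⟩

theorem MarkedArc.of_white_right {v : Fin a} (h : D.MarkedArc w ρ l x (.white v) n) :
    (∃ e : D.edges.ToType, x = .edge e ∧ e.1.tgt = v ∧ e.1.weight = n) ∨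
      ∃ i, x = .left i ∧ l i = v ∧ w (.inr i) = n := by
  cases h with
  | secondHalf e => exact .inl ⟨e, rfl, rfl, rfl⟩
  | left i => exact .inr ⟨i, rfl, rfl, rfl⟩

variable {σ : Equiv.Perm (D.MarkedVertex lr ll)} (hσ : ∀ v, σ (.white v) = .white v)
  (h : ∀ x y n, D.MarkedArc w ρ l x y n ↔ D.MarkedArc w ρ' l' (σ x) (σ y) n)

include hσ h

theorem exists_apply_edge_eq (e : D.edges.ToType) : ∃ e', σ (.edge e) = .edge e' ∧ e'.1 = e.1 := by
  have hfirst := (h _ _ _).1 (.firstHalf e)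
  have hsecond := (h _ _ _).1 (.secondHalf e)
  rw [hσ] at hfirst hsecond
  obtain ⟨e', he', hsrc, hweight⟩ | ⟨j, hj, -⟩ := hfirst.of_white_left
  · obtain ⟨e'', he'', htgt, -⟩ | ⟨i, hi, -⟩ := hsecond.of_white_right
    · obtain rfl := MarkedVertex.edge.inj (he'.symm.trans he'')
      exact ⟨e', he', FloorEdge.ext hsrc htgt hweight⟩
    · cases he'.symm.trans hi
  · obtain ⟨e', he', -⟩ | ⟨i, hi, -⟩ := hsecond.of_white_right
    · cases hj.symm.trans he'
    · cases hj.symm.trans hi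

theorem exists_symm_apply_edge_eq (e : D.edges.ToType) : ∃ e', σ.symm (.edge e) = .edge e' :=
  (exists_apply_edge_eq (σ := σ.symm) (w := w) (ρ := ρ') (ρ' := ρ) (l := l') (l' := l)
    (fun v => by rw [Equiv.symm_apply_eq, hσ])
    (fun x y n => by rw [h, Equiv.apply_symm_apply, Equiv.apply_symm_apply]) e).imp
      fun _ => And.left

theorem exists_apply_right_eq (j : Fin lr) :
    ∃ j', σ (.right j) = .right j' ∧ w (.inl j') = w (.inl j) ∧ ρ' j' = ρ j := by
  have harc := (h _ _ _).1 (.right j)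
  rw [hσ] at harc
  obtain ⟨e, he, -⟩ | ⟨j', hj', hρ, hweight⟩ := harc.of_white_left
  · obtain ⟨e', he'⟩ := exists_symm_apply_edge_eq hσ h e
    rw [← he, Equiv.symm_apply_apply] at he'
    cases he'
  · exact ⟨j', hj', hweight, hρ⟩

theorem exists_apply_left_eq (i : Fin ll) :
    ∃ i', σ (.left i) = .left i' ∧ w (.inr i') = w (.inr i) ∧ l' i' = l i := by
  have harc := (h _ _ _).1 (.left i)
  rw [hσ] at harc
  obtain ⟨e, he, -⟩ | ⟨i', hi', hl, hweight⟩ := harc.of_white_right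
  · obtain ⟨e', he'⟩ := exists_symm_apply_edge_eq hσ h e
    rw [← he, Equiv.symm_apply_apply] at he'
    cases he'
  · exact ⟨i', hi', hweight, hl⟩

theorem exists_eq_perm :
    ∃ γ : D.WeightPerm w, ρ' ∘ γ.right = ρ ∧ l' ∘ γ.left = l ∧ γ.perm = σ := by
  choose f hf hf_val using exists_apply_edge_eq hσ h
  choose r hr hr_weight hr_src using exists_apply_right_eq hσ h
  choose s hs hs_weight hs_tgt using exists_apply_left_eq hσ h
  have hf_inj : f.Injective := fun e e' he =>
    MarkedVertex.edge.inj (σ.injective (by rw [hf, hf, he]))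
  have hr_inj : r.Injective := fun j j' hj =>
    MarkedVertex.right.inj (σ.injective (by rw [hr, hr, hj]))
  have hs_inj : s.Injective := fun i i' hi =>
    MarkedVertex.left.inj (σ.injective (by rw [hs, hs, hi]))
  refine ⟨⟨.ofBijective f (Finite.injective_iff_bijective.1 hf_inj),
    .ofBijective r (Finite.injective_iff_bijective.1 hr_inj),
    .ofBijective s (Finite.injective_iff_bijective.1 hs_inj), hf_val, hr_weight, hs_weight⟩,
    funext hr_src, funext hs_tgt, Equiv.ext ?_⟩
  rintro (v | e | j | i)
  exacts [(hσ v).symm, (hf e).symm, (hr j).symm, (hs i).symm]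

end MarkedArc

theorem sum_filter_comp_symm {ι : Type*} [Fintype ι] {π : Equiv.Perm ι} {f : ι → ℕ+}
    (hf : ∀ j, f (π j) = f j) (p : ι → Fin a) (v : Fin a) :
    ∑ i with (p ∘ π.symm) i = v, ((f i : ℕ) : ℤ) = ∑ i with p i = v, ((f i : ℕ) : ℤ) := by
  rw [Finset.sum_filter, Finset.sum_filter, ← Equiv.sum_comp π]
  simp [hf]

namespace Marking

attribute [ext] Marking

/-- The transport of a marking along a relabelling. -/
def relabel (m : D.Marking k w) (γ : D.WeightPerm w) : D.Marking k w where
  rightSrc := m.rightSrc ∘ γ.right.symm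
  leftTgt := m.leftTgt ∘ γ.left.symm
  div_eq v := by
    rw [← m.div_eq v, sum_filter_comp_symm γ.weight_left, sum_filter_comp_symm γ.weight_right]
  lt := γ.perm.symm ⁻¹'o m.lt
  isStrictTotalOrder :=
    have := m.isStrictTotalOrder
    (RelEmbedding.preimage γ.perm.symm.toEmbedding m.lt).isStrictTotalOrder
  white_lt_white := m.white_lt_white
  lt_of_arc x y n h := m.lt_of_arc _ _ n <| (markedArc_perm_iff γ).2 <| by
    rwa [Equiv.apply_symm_apply, Equiv.apply_symm_apply]

theorem equivalent_relabel (m : D.Marking k w) (γ : D.WeightPerm w) :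
    m.Equivalent (m.relabel γ) :=
  ⟨γ.perm, fun _ => rfl, fun _ _ _ => markedArc_perm_iff γ, fun x y => by simp [relabel]⟩

theorem relabel_injective (m : D.Marking k w) : Function.Injective m.relabel := by
  intro γ γ' h
  have := m.isStrictTotalOrder
  have : IsWellOrder _ m.lt := { wf := Finite.wellFounded_of_trans_of_irrefl m.lt }
  have hlt (x y) : m.lt (γ.perm.symm x) (γ.perm.symm y) ↔
      m.lt (γ'.perm.symm x) (γ'.perm.symm y) :=
    iff_of_eq (congrFun₂ (congrArg Marking.lt h) x y)
  -- An automorphism of a finite total order is trivial.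
  let θ : m.lt ≃r m.lt := ⟨γ.perm.trans γ'.perm.symm, fun {x y} => by simp [← hlt]⟩
  refine WeightPerm.perm_injective (Equiv.ext fun x => ?_)
  have hθ : θ x = x := DFunLike.congr_fun
    (Subsingleton.elim θ.toInitialSeg (RelIso.refl m.lt).toInitialSeg) x
  exact (Equiv.symm_apply_eq _).1 hθ

theorem exists_relabel_eq {m m' : D.Marking k w} (h : m.Equivalent m') :
    ∃ γ, m.relabel γ = m' := by
  obtain ⟨σ, hσ, harc, hlt⟩ := h
  obtain ⟨γ, hright, hleft, rfl⟩ := exists_eq_perm hσ harc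
  refine ⟨γ, Marking.ext ?_ ?_ ?_⟩
  · simp [relabel, ← hright, Function.comp_assoc]
  · simp [relabel, ← hleft, Function.comp_assoc]
  · ext x y
    simp [relabel, hlt]

end Marking

theorem card_marking :
    Nat.card (D.Marking k w) = D.numMarkings k w * Nat.card (D.WeightPerm w) := by
  rw [numMarkings, ← Nat.card_prod]
  refine (Nat.card_eq_of_bijective (fun p : Quotient (Marking.setoid (D := D) k w) ×
    D.WeightPerm w => p.1.out.relabel p.2) ⟨?_, fun m => ?_⟩).symm
  · rintro ⟨q, γ⟩ ⟨q', γ'⟩ (h : q.out.relabel γ = q'.out.relabel γ')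
    have mk_relabel (q : Quotient (Marking.setoid (D := D) k w)) (γ) : ⟦q.out.relabel γ⟧ = q :=
      (Quotient.sound (Setoid.symm (q.out.equivalent_relabel γ))).trans q.out_eq
    obtain rfl : q = q' := by rw [← mk_relabel q γ, ← mk_relabel q' γ', ← h]
    rw [q.out.relabel_injective h]
  · obtain ⟨γ, hγ⟩ := Marking.exists_relabel_eq (Quotient.mk_out m)
    exact ⟨(⟦m⟧, γ), hγ⟩

end FloorDiagram

namespace FloorDiagram

section Labelling

variable {a m : ℕ} {D : FloorDiagram a}

/-- The floor diagram whose edges are given by a family, that is, a floor diagram with labelled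
edges. -/
def ofEdges (E : Fin m → FloorEdge a) : FloorDiagram a := ⟨Finset.univ.val.map E⟩

theorem ofEdges_val_comp (β : Fin m ≃ D.edges.ToType) : ofEdges (fun i => (β i).1) = D := by
  refine FloorDiagram.ext ?_
  conv_rhs => rw [← Multiset.map_univ_coe D.edges, ← Multiset.map_univ_val_equiv β]
  rw [Multiset.map_map]
  rfl

theorem exists_labelling {E : Fin m → FloorEdge a} (h : ofEdges E = D) :
    ∃ β : Fin m ≃ D.edges.ToType, ∀ i, (β i).1 = E i := by
  subst h
  let index : (Finset.univ.val : Multiset (Fin m)).ToType → Fin m := Sigma.fst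
  have index_bijective : index.Bijective := (Fintype.bijective_iff_surjective_and_card _).2
    ⟨fun i => ⟨⟨i, 0, Multiset.count_pos.2 (Finset.mem_univ i)⟩, rfl⟩, by simp⟩
  refine ⟨(Equiv.ofBijective index index_bijective).symm.trans (Finset.univ.val.mapEquiv E),
    fun i => ?_⟩
  exact (Multiset.mapEquiv_apply _ E _).trans
    (congrArg E ((Equiv.ofBijective index index_bijective).apply_symm_apply i))

theorem card_labelling_mul_card_perm (hD : D.edges.card = m) :
    Nat.card {E : Fin m → FloorEdge a // ofEdges E = D} *
      Nat.card {τ : Equiv.Perm D.edges.ToType // ∀ e, (τ e).1 = e.1} = m.factorial := by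
  have hm : Nat.card (Fin m ≃ D.edges.ToType) = m.factorial := by
    classical
    rw [Nat.card_eq_fintype_card, Fintype.card_equiv (Fintype.equivOfCardEq (by simp [hD])),
      Fintype.card_fin]
  choose β hβ using fun E : {E : Fin m → FloorEdge a // ofEdges E = D} => exists_labelling E.2
  rw [← hm, ← Nat.card_prod]
  refine Nat.card_eq_of_bijective (fun p => (β p.1).trans p.2.1) ⟨?_, fun β' => ?_⟩
  · rintro ⟨E, τ⟩ ⟨E', τ'⟩ (h : (β E).trans τ.1 = (β E').trans τ'.1)
    have hval (i) : (β E i).1 = (β E' i).1 :=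
      (τ.2 _).symm.trans ((congrArg Sigma.fst (DFunLike.congr_fun h i)).trans (τ'.2 _))
    obtain rfl : E = E' := Subtype.ext <| funext fun i => by rw [← hβ, ← hβ, hval]
    obtain rfl : τ = τ' := Subtype.ext <| Equiv.ext fun e => by
      simpa using DFunLike.congr_fun h ((β E).symm e)
    rfl
  · let E : {E : Fin m → FloorEdge a // ofEdges E = D} := ⟨_, ofEdges_val_comp β'⟩
    refine ⟨(E, ⟨(β E).symm.trans β', fun e => ?_⟩), Equiv.ext fun i => by simp⟩
    simpa using (hβ E ((β E).symm e)).symm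

end Labelling

variable {a m lr ll k : ℕ} {D : FloorDiagram a}

/-- The number of permutations of the right ends and of the left ends that preserve the weights. -/
noncomputable def numEndPerms (w : EndWeights lr ll) : ℕ :=
  Nat.card {p : Equiv.Perm (Fin lr) × Equiv.Perm (Fin ll) // ∀ x, w (x.map p.1 p.2) = w x}

theorem numEndPerms_pos (w : EndWeights lr ll) : 0 < numEndPerms w :=
  have : Nonempty {p : Equiv.Perm (Fin lr) × Equiv.Perm (Fin ll) // ∀ x, w (x.map p.1 p.2) = w x} :=
    ⟨1, fun x => by simp⟩
  Nat.card_pos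

theorem card_weightPerm (w : EndWeights lr ll) :
    Nat.card (D.WeightPerm w) =
      Nat.card {τ : Equiv.Perm D.edges.ToType // ∀ e, (τ e).1 = e.1} * numEndPerms w := by
  rw [numEndPerms, ← Nat.card_prod]
  exact Nat.card_congr
    { toFun γ := (⟨γ.edge, γ.val_edge⟩,
        ⟨(γ.right, γ.left), Sum.rec γ.weight_right γ.weight_left⟩)
      invFun p := ⟨p.1.1, p.2.1.1, p.2.1.2, p.1.2, fun j => p.2.2 (.inl j),
        fun i => p.2.2 (.inr i)⟩
      left_inv _ := rfl
      right_inv _ := rfl }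

/-- The marked floor diagrams with `m` edges labelled by `Fin m` and with labelled ends. -/
abbrev LabelledMarking (a m k : ℕ) (w : EndWeights lr ll) : Type :=
  Σ E : Fin m → FloorEdge a, (ofEdges E).Marking k w

theorem card_labelledMarking (hD : D.edges.card = m) (w : EndWeights lr ll) :
    Nat.card {x : LabelledMarking a m k w // ofEdges x.1 = D} =
      m.factorial * numEndPerms w * D.numMarkings k w := by
  have e : {x : LabelledMarking a m k w // ofEdges x.1 = D} ≃
      {E : Fin m → FloorEdge a // ofEdges E = D} × D.Marking k w :=
    { toFun x := (⟨x.1.1, x.2⟩, cast (congrArg (Marking · k w) x.2) x.1.2)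
      invFun p := ⟨⟨p.1.1, cast (congrArg (Marking · k w) p.1.2.symm) p.2⟩, p.1.2⟩
      left_inv := by rintro ⟨x, rfl⟩; rfl
      right_inv := by rintro ⟨⟨E, rfl⟩, M⟩; rfl }
  rw [Nat.card_congr e, Nat.card_prod, card_marking, card_weightPerm,
    ← card_labelling_mul_card_perm hD]
  ring

end FloorDiagram

theorem FloorDiagram.div_ofEdges {a m : ℕ} (E : Fin m → FloorEdge a) (v : Fin a) :
    (ofEdges E).div v =
      netFlow (fun i => (E i).src) (fun i => (E i).tgt) (fun i => ((E i).weight : ℕ)) v := by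
  simp only [div, ofEdges, Multiset.filter_map, Multiset.map_map]
  change ∑ i with (E i).tgt = v, ((E i).weight : ℤ) - ∑ i with (E i).src = v, ((E i).weight : ℤ) =
    ∑ i, ((E i).weight : ℤ) * _
  simp [Finset.sum_filter, mul_sub, Finset.sum_sub_distrib]

/-- The combinatorial type of a marked floor diagram with labelled edges and ends: the end points
of the edges and the white vertices to which the ends are attached, but no weights. -/
structure CombType (a m lr ll : ℕ) where
  src : Fin m → Fin a
  tgt : Fin m → Fin a
  rightSrc : Fin lr → Fin a
  leftTgt : Fin ll → Fin a
  src_lt_tgt : ∀ i, src i < tgt i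

namespace CombType

open FloorDiagram

variable {a m lr ll k : ℕ} {w : EndWeights lr ll}

noncomputable instance : Fintype (CombType a m lr ll) :=
  @Fintype.ofFinite _ <| .of_injective (fun C => (C.src, C.tgt, C.rightSrc, C.leftTgt)) <| by
    rintro ⟨_, _, _, _, _⟩ ⟨_, _, _, _, _⟩ h
    simpa using h

variable (C : CombType a m lr ll)

/-- The labelled edges of combinatorial type `C` with given weights. -/
def edges (y : Fin m → ℕ+) (i : Fin m) : FloorEdge a := ⟨C.src i, C.tgt i, C.src_lt_tgt i, y i⟩

/-- The divergences that the edges have to provide, in order for every white vertex to have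
divergence `k` once the ends are attached. -/
def requiredDiv (k : ℕ) (w : EndWeights lr ll) (v : Fin a) : ℤ :=
  k - ∑ i with C.leftTgt i = v, ((w (.inr i) : ℕ) : ℤ) +
    ∑ j with C.rightSrc j = v, ((w (.inl j) : ℕ) : ℤ)

/-- The vertex orders of markings of combinatorial type `C`. The vertices are, in this order, the
white ones, those on the edges, and those at the tips of the right and of the left ends. -/
@[ext]
structure MarkedOrder where
  lt : Fin a ⊕ Fin m ⊕ Fin lr ⊕ Fin ll → Fin a ⊕ Fin m ⊕ Fin lr ⊕ Fin ll → Prop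
  isStrictTotalOrder : IsStrictTotalOrder _ lt
  white_lt_white : ∀ u v, lt (.inl u) (.inl v) ↔ u < v
  src_lt_edge : ∀ i, lt (.inl (C.src i)) (.inr (.inl i))
  edge_lt_tgt : ∀ i, lt (.inr (.inl i)) (.inl (C.tgt i))
  white_lt_right : ∀ j, lt (.inl (C.rightSrc j)) (.inr (.inr (.inl j)))
  left_lt_white : ∀ i, lt (.inr (.inr (.inr i))) (.inl (C.leftTgt i))

instance : Finite C.MarkedOrder := .of_injective _ fun _ _ => MarkedOrder.ext

/-- A labelling of the edges of `ofEdges E` by `Fin m`, matching the family `E`. -/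
noncomputable def labelling (E : Fin m → FloorEdge a) : Fin m ≃ (ofEdges E).edges.ToType :=
  (exists_labelling rfl).choose

theorem val_labelling (E : Fin m → FloorEdge a) (i) : (labelling E i).1 = E i :=
  (exists_labelling rfl).choose_spec i

theorem labelling_symm (E : Fin m → FloorEdge a) (e) : E ((labelling E).symm e) = e.1 :=
  (val_labelling E _).symm.trans (congrArg _ ((labelling E).apply_symm_apply e))

/-- The vertices of the marked floor diagrams obtained from a floor diagram with labelled edges. -/
noncomputable def vertexEquiv (E : Fin m → FloorEdge a) :
    Fin a ⊕ Fin m ⊕ Fin lr ⊕ Fin ll ≃ (ofEdges E).MarkedVertex lr ll :=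
  MarkedVertex.sumEquiv (labelling E)

/-- The combinatorial type of a marking of a floor diagram with labelled edges. -/
def ofMarking {E : Fin m → FloorEdge a} (M : (ofEdges E).Marking k w) : CombType a m lr ll :=
  ⟨fun i => (E i).src, fun i => (E i).tgt, M.rightSrc, M.leftTgt, fun i => (E i).src_lt_tgt⟩

theorem requiredDiv_ofMarking {E : Fin m → FloorEdge a} (M : (ofEdges E).Marking k w) :
    (ofMarking M).requiredDiv k w = (ofEdges E).div := by
  funext v
  change k - ∑ i with M.leftTgt i = v, ((w (.inr i) : ℕ) : ℤ) +
    ∑ j with M.rightSrc j = v, ((w (.inl j) : ℕ) : ℤ) = _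
  rw [← M.div_eq v]
  ring

/-- The vertex order of a marking of a floor diagram with labelled edges. -/
def orderOfMarking {E : Fin m → FloorEdge a} (M : (ofEdges E).Marking k w) :
    (ofMarking M).MarkedOrder where
  lt := vertexEquiv E ⁻¹'o M.lt
  isStrictTotalOrder :=
    have := M.isStrictTotalOrder
    (RelEmbedding.preimage (vertexEquiv E).toEmbedding M.lt).isStrictTotalOrder
  white_lt_white := M.white_lt_white
  src_lt_edge i := by
    have := M.lt_of_arc _ _ _ (.firstHalf (labelling E i))
    rwa [val_labelling] at this
  edge_lt_tgt i := by
    have := M.lt_of_arc _ _ _ (.secondHalf (labelling E i))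
    rwa [val_labelling] at this
  white_lt_right j := M.lt_of_arc _ _ _ (.right j)
  left_lt_white i := M.lt_of_arc _ _ _ (.left i)

/-- The marking with the given combinatorial type, edge weights and vertex order. -/
def marking {y : Fin m → ℕ+} (hy : y ∈ positiveFlows C.src C.tgt 1 (C.requiredDiv k w))
    (r : C.MarkedOrder) : (ofEdges (C.edges y)).Marking k w where
  rightSrc := C.rightSrc
  leftTgt := C.leftTgt
  div_eq v := by
    have h : (ofEdges (C.edges y)).div v = C.requiredDiv k w v :=
      (div_ofEdges _ v).trans (congrFun hy.2 v)
    rw [h, requiredDiv]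
    ring
  lt := (vertexEquiv (C.edges y)).symm ⁻¹'o r.lt
  isStrictTotalOrder :=
    have := r.isStrictTotalOrder
    (RelEmbedding.preimage (vertexEquiv (C.edges y)).symm.toEmbedding r.lt).isStrictTotalOrder
  white_lt_white := r.white_lt_white
  lt_of_arc x z n h := by
    cases h with
    | firstHalf e => exact labelling_symm (C.edges y) e ▸ r.src_lt_edge ((labelling _).symm e)
    | secondHalf e => exact labelling_symm (C.edges y) e ▸ r.edge_lt_tgt ((labelling _).symm e)
    | right j => exact r.white_lt_right j
    | left i => exact r.left_lt_white i

/-- A marked floor diagram with labelled edges and ends is given by its combinatorial type, the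
weights of its edges, and its vertex order. -/
noncomputable def labelledMarkingEquiv : LabelledMarking a m k w ≃
    Σ C : CombType a m lr ll,
      positiveFlows C.src C.tgt 1 (C.requiredDiv k w) × C.MarkedOrder where
  toFun x := ⟨ofMarking x.2, ⟨fun i => (x.1 i).weight, fun _ => Nat.modEq_one,
    (funext (div_ofEdges x.1)).symm.trans (requiredDiv_ofMarking x.2).symm⟩, orderOfMarking x.2⟩
  invFun x := ⟨x.1.edges x.2.1, x.1.marking x.2.1.2 x.2.2⟩
  left_inv x := congrArg (Sigma.mk x.1) <| Marking.ext rfl rfl <| funext₂ fun y z =>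
    congrArg₂ x.2.lt ((vertexEquiv x.1).apply_symm_apply y) ((vertexEquiv x.1).apply_symm_apply z)
  right_inv x := congrArg (Sigma.mk x.1) <| Prod.ext rfl <| MarkedOrder.ext <| by
    ext
    simp [marking, orderOfMarking]

end CombType

theorem finsum_comp_eq_finsum_card_smul {α β M : Type*} [AddCommMonoid M] [Finite α] (g : α → β)
    (f : β → M) : ∑ᶠ x, f (g x) = ∑ᶠ y, Nat.card {x // g x = y} • f y := by
  classical
  have := Fintype.ofFinite α
  rw [finsum_eq_sum_of_fintype, Finset.sum_comp,
    finsum_eq_sum_of_support_subset (s := Finset.univ.image g)]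
  · simp_rw [Nat.card_eq_fintype_card, Fintype.card_subtype]
  · intro y hy
    have hcard : Nat.card {x // g x = y} ≠ 0 := fun h => hy (by simp only [h, zero_smul])
    obtain ⟨x, hx⟩ := (Nat.card_ne_zero.1 hcard).1
    simp [← hx]

namespace CombType

open FloorDiagram

variable {a m lr ll k : ℕ} {w : EndWeights lr ll}

instance (C : CombType a m lr ll) (s : ℕ) (d : Fin a → ℤ) :
    Finite (positiveFlows C.src C.tgt s d) :=
  finite_positiveFlows (h := fun v : Fin a => (v : ℕ)) (fun i => Nat.cast_lt.2 (C.src_lt_tgt i)) s d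

instance : Finite (LabelledMarking a m k w) := .of_equiv _ labelledMarkingEquiv.symm

theorem finsum_labelledMarking (f : (Fin m → FloorEdge a) → ℚ) :
    ∑ᶠ x : LabelledMarking a m k w, f x.1 = ∑ C : CombType a m lr ll,
      (Nat.card C.MarkedOrder : ℚ) *
        ∑ᶠ y ∈ positiveFlows C.src C.tgt 1 (C.requiredDiv k w), f (C.edges y) := by
  have (C : CombType a m lr ll) :=
    Fintype.ofFinite (positiveFlows C.src C.tgt 1 (C.requiredDiv k w))
  have (C : CombType a m lr ll) := Fintype.ofFinite C.MarkedOrder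
  rw [← finsum_comp_equiv labelledMarkingEquiv.symm, finsum_eq_sum_of_fintype, Fintype.sum_sigma]
  refine Finset.sum_congr rfl fun C _ => ?_
  rw [← finsum_set_coe_eq_finsum_mem, finsum_eq_sum_of_fintype, Fintype.sum_prod_type,
    Finset.mul_sum]
  refine Finset.sum_congr rfl fun y _ => ?_
  change ∑ _ : C.MarkedOrder, f (C.edges y) = _
  rw [Finset.sum_const, nsmul_eq_mul, Nat.card_eq_fintype_card, Finset.card_univ]

end CombType

namespace FloorDiagram

open CombType

variable {a m lr ll k : ℕ} {w : EndWeights lr ll}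

theorem IsAdmissible.card_edges {D : FloorDiagram a} {g : ℕ} {c : WithTop ℤ}
    (hD : D.IsAdmissible g c) : D.edges.card = g + a - 1 := by
  have hgenus := hD.2.1
  rw [genus] at hgenus
  omega

theorem finite_setOf_numMarkings_ne_zero (m : ℕ) :
    {D : FloorDiagram a | D.edges.card = m ∧ D.numMarkings k w ≠ 0}.Finite := by
  refine (Set.finite_range fun x : LabelledMarking a m k w => ofEdges x.1).subset ?_
  rintro D ⟨hD, hν⟩
  have hcard : Nat.card {x : LabelledMarking a m k w // ofEdges x.1 = D} ≠ 0 := by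
    rw [card_labelledMarking hD]
    exact mul_ne_zero (mul_ne_zero m.factorial_ne_zero (numEndPerms_pos w).ne') hν
  obtain ⟨x, hx⟩ := (Nat.card_ne_zero.1 hcard).1
  exact ⟨x, hx⟩

theorem finsum_numMarkings_mul {s : Set (FloorDiagram a)} (hs : ∀ D ∈ s, D.edges.card = m)
    (f : FloorDiagram a → ℚ) :
    (m.factorial * numEndPerms w : ℚ) * ∑ᶠ D ∈ s, D.numMarkings k w * f D =
      ∑ C : CombType a m lr ll, (Nat.card C.MarkedOrder : ℚ) *
        ∑ᶠ y ∈ {y ∈ positiveFlows C.src C.tgt 1 (C.requiredDiv k w) | ofEdges (C.edges y) ∈ s},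
          f (ofEdges (C.edges y)) := by
  calc
    _ = ∑ᶠ D, Nat.card {x : LabelledMarking a m k w // ofEdges x.1 = D} • s.indicator f D := by
      rw [finsum_mem_def, ← smul_eq_mul, smul_finsum]
      refine finsum_congr fun D => ?_
      by_cases hD : D ∈ s
      · rw [Set.indicator_of_mem hD, Set.indicator_of_mem hD, card_labelledMarking (hs D hD)]
        simp [mul_assoc]
      · simp [hD]
    _ = ∑ᶠ x : LabelledMarking a m k w, s.indicator f (ofEdges x.1) :=
      (finsum_comp_eq_finsum_card_smul _ _).symm
    _ = _ := by
      rw [finsum_labelledMarking fun E => s.indicator f (ofEdges E)]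
      refine Finset.sum_congr rfl fun C _ => congrArg _ ?_
      rw [finsum_mem_def, finsum_mem_def]
      refine finsum_congr fun y => ?_
      classical simp only [Set.indicator_apply, Set.mem_ofPred_eq, ite_and]

end FloorDiagram

namespace CombType

open FloorDiagram

variable {a m lr ll k : ℕ} {w : EndWeights lr ll} (C : CombType a m lr ll)

/-- The simple graph underlying the floor diagrams of combinatorial type `C`. -/
def graph : SimpleGraph (Fin a) :=
  SimpleGraph.fromRel fun u v => ∃ i, C.src i = u ∧ C.tgt i = v

theorem graph_ofEdges_edges (y : Fin m → ℕ+) : (ofEdges (C.edges y)).graph = C.graph := by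
  simp [FloorDiagram.graph, graph, ofEdges, edges]

variable {C}

theorem isAdmissible_ofEdges_edges {g : ℕ} (hm : m = g + a - 1) {c : WithTop ℤ} {y : Fin m → ℕ+}
    (hy : netFlow C.src C.tgt (fun i => (y i : ℕ)) = C.requiredDiv k w) :
    (ofEdges (C.edges y)).IsAdmissible g c ↔
      C.graph.Connected ∧ ∀ v, (C.requiredDiv k w v : WithTop ℤ) ≤ c := by
  have hdiv (v) : (ofEdges (C.edges y)).div v = C.requiredDiv k w v :=
    (div_ofEdges _ v).trans (congrFun hy v)
  simp only [IsAdmissible, graph_ofEdges_edges, hdiv]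
  refine and_congr_right fun hconn => and_iff_right ?_
  have := hconn.nonempty
  have : 0 < a := Fin.pos_iff_nonempty.2 this
  simp [genus, ofEdges]
  omega

theorem setOf_mem_positiveFlows_isAdmissible {g : ℕ} (hm : m = g + a - 1) (c : WithTop ℤ) (s : ℕ) :
    {y ∈ positiveFlows C.src C.tgt 1 (C.requiredDiv k w) | ofEdges (C.edges y) ∈
      {D : FloorDiagram a | D.IsAdmissible g c ∧ ∀ e ∈ D.edges, (e.weight : ℕ) ≡ 1 [MOD s]}} =
    {y ∈ positiveFlows C.src C.tgt s (C.requiredDiv k w) |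
      C.graph.Connected ∧ ∀ v, (C.requiredDiv k w v : WithTop ℤ) ≤ c} := by
  ext y
  have hmod : (∀ e ∈ (ofEdges (C.edges y)).edges, (e.weight : ℕ) ≡ 1 [MOD s]) ↔
      ∀ i, (y i : ℕ) ≡ 1 [MOD s] := by
    simp [ofEdges, edges]
  calc
    _ ↔ netFlow C.src C.tgt (fun i => (y i : ℕ)) = C.requiredDiv k w ∧
        (C.graph.Connected ∧ ∀ v, (C.requiredDiv k w v : WithTop ℤ) ≤ c) ∧
          ∀ i, (y i : ℕ) ≡ 1 [MOD s] :=
      (and_congr_left' (and_iff_right fun _ => Nat.modEq_one)).trans <|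
        and_congr_right fun hy => and_congr (isAdmissible_ofEdges_edges hm hy) hmod
    _ ↔ _ := by
      rw [← and_assoc, and_right_comm, and_comm (a := _ = _)]
      rfl

end CombType

section Polynomiality

open FloorDiagram

variable {a m lr ll k : ℕ} {S : Set (EndWeights lr ll)}

theorem numEndPerms_inv_mem_piecewisePolynomialOn :
    (fun w : EndWeights lr ll => (numEndPerms w : ℚ)⁻¹) ∈ piecewisePolynomialOn S := by
  refine piecewisePolynomialOn_congr (fun w _ => ?_) <| comp_sign_mem_piecewisePolynomialOn
    (τ := (Fin lr ⊕ Fin ll) × (Fin lr ⊕ Fin ll))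
    (fun t => sub_mem (coord_mem_affineOn t.1) (coord_mem_affineOn t.2))
    fun σ => (Nat.card {p : Equiv.Perm (Fin lr) × Equiv.Perm (Fin ll) //
      ∀ x, σ (x.map p.1 p.2, x) = 0} : ℚ)⁻¹
  simp only [numEndPerms, Pi.sub_apply, sign_eq_zero_iff, sub_eq_zero, Nat.cast_inj, PNat.coe_inj]

namespace CombType

variable (C : CombType a m lr ll)

theorem requiredDiv_mem_affineOn (v : Fin a) :
    (fun w => (C.requiredDiv k w v : ℚ)) ∈ affineOn S := by
  convert add_mem (sub_mem (const_mem_affineOn (S := S) (k : ℚ))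
    (sum_mem (t := {i | C.leftTgt i = v}) fun i _ => coord_mem_affineOn (Sum.inr i)))
    (sum_mem (t := {j | C.rightSrc j = v}) fun j _ => coord_mem_affineOn (Sum.inl j)) with w
  simp [requiredDiv]

theorem requiredDiv_modEq {s : ℕ} {w w' : EndWeights lr ll}
    (h : ∀ x, (w x : ℕ) ≡ w' x [MOD s]) (v : Fin a) :
    C.requiredDiv k w v ≡ C.requiredDiv k w' v [ZMOD s] :=
  ((Int.ModEq.refl _).sub (Int.ModEq.sum fun _ _ => Int.natCast_modEq_iff.2 (h _))).add
    (Int.ModEq.sum fun _ _ => Int.natCast_modEq_iff.2 (h _))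

open Classical in
theorem requiredDiv_le_mem_piecewisePolynomialOn (c : WithTop ℤ) :
    (fun w => if ∀ v, (C.requiredDiv k w v : WithTop ℤ) ≤ c then 1 else 0) ∈
      piecewisePolynomialOn S := by
  cases c with
  | top => simpa using const_mem_piecewisePolynomialOn 1
  | coe c =>
    refine piecewisePolynomialOn_congr (fun w _ => ?_) <| comp_sign_mem_piecewisePolynomialOn
      (fun v => sub_mem (C.requiredDiv_mem_affineOn (k := k) v) (const_mem_affineOn (c : ℚ)))
      fun σ => if ∀ v, σ v ≤ 0 then 1 else 0
    have hle (v) : SignType.sign ((C.requiredDiv k w v : ℚ) - c) ≤ 0 ↔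
        (C.requiredDiv k w v : WithTop ℤ) ≤ c := by
      rw [WithTop.coe_le_coe, sign_nonpos_iff, sub_nonpos, Int.cast_le]
    simp [hle]

end CombType

open Classical in
theorem finsum_numMarkings_mul_prod_pow (g k : ℕ) (c : WithTop ℤ) (s r : ℕ)
    (w : EndWeights lr ll) :
    ∑ᶠ D ∈ {D : FloorDiagram a | D.IsAdmissible g c ∧ ∀ e ∈ D.edges, (e.weight : ℕ) ≡ 1 [MOD s]},
        (D.numMarkings k w : ℚ) * (D.edges.map fun e => (e.weight : ℕ)).prod ^ r =
      ((g + a - 1).factorial : ℚ)⁻¹ * (numEndPerms w : ℚ)⁻¹ *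
        ∑ C : CombType a (g + a - 1) lr ll, (if C.graph.Connected then 1 else 0) *
          Nat.card C.MarkedOrder *
          (if ∀ v, (C.requiredDiv k w v : WithTop ℤ) ≤ c then 1 else 0) *
          ∑ᶠ y ∈ positiveFlows C.src C.tgt s (C.requiredDiv k w),
            MvPolynomial.eval (fun e => ((y e : ℕ) : ℚ)) ((∏ i, MvPolynomial.X i) ^ r) := by
  have hpos : (numEndPerms w : ℚ) ≠ 0 := Nat.cast_ne_zero.2 (numEndPerms_pos w).ne'
  rw [← mul_inv, eq_inv_mul_iff_mul_eq₀ (mul_ne_zero (by positivity) hpos),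
    finsum_numMarkings_mul fun D hD => hD.1.card_edges]
  refine Finset.sum_congr rfl fun C _ => ?_
  rw [C.setOf_mem_positiveFlows_isAdmissible rfl]
  have hprod (y) : ((ofEdges (C.edges y)).edges.map fun e => (e.weight : ℕ)).prod =
      ∏ i, (y i : ℕ) := by
    rw [ofEdges, Multiset.map_map]
    rfl
  by_cases hconn : C.graph.Connected <;>
    by_cases hle : ∀ v, (C.requiredDiv k w v : WithTop ℤ) ≤ c <;> simp [hconn, hle, hprod]

theorem finsum_numMarkings_mem_piecewisePolynomialOn (g k : ℕ) (c : WithTop ℤ) {s : ℕ} (hs : 0 < s)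
    (hS : ∀ w ∈ S, ∀ w' ∈ S, ∀ x, (w x : ℕ) ≡ w' x [MOD s]) (r : ℕ) :
    (fun w => ∑ᶠ D ∈ {D : FloorDiagram a |
        D.IsAdmissible g c ∧ ∀ e ∈ D.edges, (e.weight : ℕ) ≡ 1 [MOD s]},
      (D.numMarkings k w : ℚ) * (D.edges.map fun e => (e.weight : ℕ)).prod ^ r) ∈
    piecewisePolynomialOn S := by
  classical
  simp only [finsum_numMarkings_mul_prod_pow]
  refine mul_mem (mul_mem (const_mem_piecewisePolynomialOn _)
    numEndPerms_inv_mem_piecewisePolynomialOn) ?_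
  have hterm (C : CombType a (g + a - 1) lr ll) := mul_mem
    (mul_mem (const_mem_piecewisePolynomialOn
      ((if C.graph.Connected then 1 else 0) * Nat.card C.MarkedOrder))
      (C.requiredDiv_le_mem_piecewisePolynomialOn (k := k) c))
    (finsum_positiveFlows_mem_piecewisePolynomialOn (S := S) (h := fun v : Fin a => (v : ℕ))
      (fun i => Nat.cast_lt.2 (C.src_lt_tgt i)) (fun v => C.requiredDiv_mem_affineOn (k := k) v) hs
      (fun w hw w' hw' => C.requiredDiv_modEq (hS w hw w' hw')) ((∏ i, MvPolynomial.X i) ^ r))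
  convert sum_mem fun C (_ : C ∈ Finset.univ) => hterm C with w
  simp

end Polynomiality

section FloorCount

open FloorDiagram

variable {a lr ll : ℕ} (g k : ℕ) (c : WithTop ℤ) (w : EndWeights lr ll)

variable (a) in
/-- The floor diagrams of genus `g` with divergences at most `c` that have a marking, i.e. those
contributing to the floor count. -/
noncomputable def markedDiagrams : Finset (FloorDiagram a) :=
  ((finite_setOf_numMarkings_ne_zero (k := k) (w := w) (g + a - 1)).subset
    fun _ (hD : _ ∧ _) => ⟨hD.1.card_edges, hD.2⟩ :
      {D : FloorDiagram a | D.IsAdmissible g c ∧ D.numMarkings k w ≠ 0}.Finite).toFinset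

theorem finsum_numMarkings_smul {M : Type*} [AddCommMonoid M] (p : FloorDiagram a → Prop)
    [DecidablePred p] (f : FloorDiagram a → M) :
    ∑ᶠ D ∈ {D : FloorDiagram a | D.IsAdmissible g c ∧ p D}, D.numMarkings k w • f D =
      ∑ D ∈ markedDiagrams a g k c w, D.numMarkings k w • if p D then f D else 0 := by
  rw [← finsum_mem_coe_finset, finsum_mem_def, finsum_mem_def]
  refine finsum_congr fun D => ?_
  classical
  by_cases hp : p D <;> by_cases hD : D.numMarkings k w = 0 <;>
    simp [Set.indicator_apply, markedDiagrams, hp, hD]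

variable (a) in
/-- The coefficient of the hyperbolic plane in the arithmetic floor count with odd ends: a floor
diagram whose marked weights have product `P` contributes `⌊P / 2⌋` for every marking. -/
noncomputable def hyperbolicCount : ℕ :=
  ∑ D ∈ markedDiagrams a g k c w, D.numMarkings k w • (((D.markedWeights w).prod : ℕ) / 2)

variable {w}

theorem floorCount_eq (K : Type u) [Field K] [CharZero K] (hw : ∀ x, Odd (w x : ℕ)) :
    floorCount K k a g c w = hyperbolicCount a g k c w • GW.hyperbolic K +
      ∑ᶠ D ∈ {D : FloorDiagram a | D.IsAdmissible g c ∧ D.IsOdd}, D.numMarkings k w •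
        GW.unitForm ((∏ j, natUnit K (w (Sum.inl j))) * ∏ j, natUnit K (w (Sum.inr j))) := by
  classical
  calc floorCount K k a g c w
      = ∑ᶠ D ∈ {D : FloorDiagram a | D.IsAdmissible g c ∧ True},
          D.numMarkings k w • D.mult K w := by
        simp only [and_true]
        rfl
    _ = ∑ D ∈ markedDiagrams a g k c w, D.numMarkings k w • D.mult K w := by
        simp only [finsum_numMarkings_smul, if_true]
    _ = _ := by
        simp only [finsum_numMarkings_smul, fun D => mult_eq (a := a) D w K hw, hyperbolicCount,
          smul_add, Finset.sum_add_distrib, Finset.sum_smul, smul_assoc]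

theorem two_mul_hyperbolicCount (hw : ∀ x, Odd (w x : ℕ)) :
    2 * (hyperbolicCount a g k c w : ℚ) =
      (∏ x, ((w x : ℕ) : ℚ)) *
        (∑ᶠ D ∈ {D : FloorDiagram a |
            D.IsAdmissible g c ∧ ∀ e ∈ D.edges, (e.weight : ℕ) ≡ 1 [MOD 1]},
          (D.numMarkings k w : ℚ) * (D.edges.map fun e => (e.weight : ℕ)).prod ^ 2) -
      ∑ᶠ D ∈ {D : FloorDiagram a |
          D.IsAdmissible g c ∧ ∀ e ∈ D.edges, (e.weight : ℕ) ≡ 1 [MOD 2]},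
        (D.numMarkings k w : ℚ) * (D.edges.map fun e => (e.weight : ℕ)).prod ^ 0 := by
  classical
  have hprod (D : FloorDiagram a) : (((D.markedWeights w).prod : ℕ) : ℚ) =
      (D.edges.map fun e => (e.weight : ℕ)).prod ^ 2 * ∏ x, ((w x : ℕ) : ℚ) := by
    rw [prod_markedWeights, PNat.mul_coe, PNat.pow_coe, ← PNat.coe_coeMonoidHom,
      map_multiset_prod, map_prod, Multiset.map_map]
    simp
  simp only [← nsmul_eq_mul, finsum_numMarkings_smul, hyperbolicCount, Nat.cast_sum,
    Finset.mul_sum, ← Finset.sum_sub_distrib]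
  refine Finset.sum_congr rfl fun D _ => ?_
  have h := two_mul_prod_markedWeights_div_two D w hw
  rw [hprod] at h
  have hodd : D.IsOdd ↔ ∀ e ∈ D.edges, (e.weight : ℕ) ≡ 1 [MOD 2] := by
    simp only [IsOdd, Nat.odd_iff, Nat.ModEq]
  simp only [nsmul_eq_mul, Nat.cast_mul, pow_zero, ← hodd, Nat.modEq_one, implies_true,
    if_true]
  linear_combination (D.numMarkings k w : ℚ) * h

theorem isPiecewisePolynomialOn_hyperbolicCount :
    IsPiecewisePolynomialOn {w : EndWeights lr ll | ∀ x, Odd (w x : ℕ)}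
      fun w => hyperbolicCount a g k c w := by
  apply isPiecewisePolynomialOn_of_mem
  have hprod : (∏ x, fun w : EndWeights lr ll => ((w x : ℕ) : ℚ)) ∈
      piecewisePolynomialOn {w | ∀ x, Odd (w x : ℕ)} :=
    prod_mem fun x _ => affineOn_le_piecewisePolynomialOn (coord_mem_affineOn x)
  refine piecewisePolynomialOn_congr (fun w hw => ?_) <|
    mul_mem (const_mem_piecewisePolynomialOn (1 / 2)) <| sub_mem (mul_mem hprod
      (finsum_numMarkings_mem_piecewisePolynomialOn (a := a) g k c one_pos
        (fun _ _ _ _ _ => Nat.modEq_one) 2))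
      (finsum_numMarkings_mem_piecewisePolynomialOn (a := a) g k c two_pos
        (fun w hw w' hw' x => by
          rw [Nat.ModEq, Nat.odd_iff.1 (hw x), Nat.odd_iff.1 (hw' x)]) 0)
  simp only [Pi.mul_apply, Pi.sub_apply, Finset.prod_apply, Int.cast_natCast,
    ← two_mul_hyperbolicCount (a := a) g k c hw]
  ring

end FloorCount

theorem theorem5p7_general (k a g lr ll : ℕ) (c : WithTop ℤ) :
    ∃ M : EndWeights lr ll → ℤ,
      (∀ (K : Type u) [Field K] [CharZero K] (w : EndWeights lr ll), (∀ x, Odd (w x : ℕ)) →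
        floorCount K k a g c w = M w • GW.hyperbolic K +
          ∑ᶠ (D : FloorDiagram a) (_ : D.IsAdmissible g c ∧ D.IsOdd), D.numMarkings k w •
            GW.unitForm ((∏ j, natUnit K (w (Sum.inl j))) * ∏ j, natUnit K (w (Sum.inr j)))) ∧
      IsPiecewisePolynomialOn {w : EndWeights lr ll | ∀ x, Odd (w x : ℕ)} M := by
  refine ⟨fun w => hyperbolicCount a g k c w, fun K _ _ w hw => ?_,
    isPiecewisePolynomialOn_hyperbolicCount g k c⟩
  rw [natCast_zsmul]
  exact floorCount_eq g k c K hw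

theorem theorem5p7 {K : Type u} [Field K] [CharZero K] (k a g lr ll : ℕ)
    (ha : 1 ≤ a) (hr : 1 ≤ lr) (hl : 1 ≤ ll)
    -- the divergences of floor diagrams are bounded by `k`, or not bounded at all
    (c : WithTop ℤ) (hc : c = ((k : ℤ) : WithTop ℤ) ∨ c = ⊤) :
    ∃ M : EndWeights lr ll → ℤ,
      (∀ w ∈ oddEndWeights k a lr ll, ∃ i : FloorDiagram a → ℕ,
        floorCount K k a g c w = M w • GW.hyperbolic K +
          ∑ᶠ (D : FloorDiagram a) (_ : D.IsAdmissible g c ∧ D.IsOdd), D.numMarkings k w •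
            GW.unitForm ((-1) ^ i D * (∏ j, natUnit K (w (Sum.inl j))) *
              (∏ j, natUnit K (w (Sum.inr j))))) ∧
      IsPiecewisePolynomialOn (oddEndWeights k a lr ll) M := by
  obtain ⟨M, hM, hpoly⟩ := theorem5p7_general k a g lr ll c
  exact ⟨M, fun w hw => ⟨0, by simpa only [Pi.zero_apply, pow_zero, one_mul] using hM K w hw.1⟩,
    hpoly.mono fun w hw => hw.1⟩
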